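/- Let $N\ge 0$ and let $\mathbf c(\mathbb R^N)$ be the Banach space of sequences $x=(x_n)_{n\in\mathbb Z}$ in $\mathbb R^N$ with $x_n\to 0$ as $|n|\to\infty$, with the supremum norm. Let $a\colon\mathbb Z\times S^1\to GL(N,\mathbb R)$, $(n,\lambda)\mapsto a_n(\lambda)$, be a continuous map such that, as $n\to\pm\infty$, $a_n(\lambda)$ converges uniformly in $\lambda\in S^1$ to matrices $a(\lambda,\pm\infty)\in GL(N,\mathbb R)$ which are hyperbolic, i.e. have no complex eigenvalue of modulus $1$. For $\lambda\in S^1$ let $L_\lambda=S-A_\lambda\colon\mathbf c(\mathbb R^N)\to\mathbf c(\mathbb R^N)$ be the bounded operator $(L_\lambda x)_n=x_{n+1}-a_n(\lambda)x_n$, and let $E^s(\lambda,\pm\infty)\subseteq\mathbb R^N$ be the subspace of the real vectors in the sum of the generalized eigenspaces in $\mathbb C^N$ of $a(\lambda,\pm\infty)$ for the eigenvalues of modulus less than $1$. Then: (i) $L_\lambda$ is a Fredholm operator for every $\lambda\in S^1$. (ii) The families $E^s(\lambda,\pm\infty)$, $\lambda\in S^1$, topologized as subspaces of $S^1\times\mathbb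 R^N$, are vector bundles $E^s(\pm\infty)$ over $S^1$, the family $L$ is continuous in the operator norm and has an index bundle, and $$\operatorname{Ind}L=[E^s(+\infty)]-[E^s(-\infty)]\in KO(S^1).$$ Here $KO(S^1)$ is the group completion of the semigroup of isomorphism classes of real vector bundles over $S^1$, and $\operatorname{Ind}L=[E]-[\Theta(V)]$, where $V\subseteq\mathbf c(\mathbb R^N)$ is any finite dimensional subspace with $\operatorname{Im}L_\lambda+V=\mathbf c(\mathbb R^N)$ for all $\lambda\in S^1$ (such subspaces exist), $E$ is the vector bundle over $S^1$ with fibres $E_\lambda=L_\lambda^{-1}(V)$ (topologized as a subspace of $S^1\times\mathbf c(\mathbb R^N)$), $\Theta(V)$ is the trivial bundle with fibre $V$, and the difference does not depend on the choice of $V$. (iii) In particular, for every $\lambda\in S^1$, $$\operatorname{ind}L_\lambda=\dim\operatorname{Ker}L_\lambda-\dim\operatorname{Coker}L_\lambda=\dim E^s(\lambda,+\infty)-\dim E^s(\lambda,-\infty).$$ -/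

import Mathlib

open Filter Topology Bundle
open scoped ZeroAtInfty

noncomputable section

/-! ### Real vector bundles, `Vect(B)` and `KO(B)` -/

/-- A real vector bundle of finite rank over `B` (with fibres in `Type`). The model fibre is fixed,
which is no restriction over a connected base such as the circle. -/
structure RealVectorBundle (B : Type) [TopologicalSpace B] where
  model : Type
  fiber : B → Type
  [modelNormedAddCommGroup : NormedAddCommGroup model]
  [modelNormedSpace : NormedSpace ℝ model]
  [modelFiniteDimensional : FiniteDimensional ℝ model]
  [fiberAddCommGroup : ∀ b, AddCommGroup (fiber b)]
  [fiberModule : ∀ b, Module ℝ (fiber b)]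
  [fiberTopologicalSpace : ∀ b, TopologicalSpace (fiber b)]
  [totalTopologicalSpace : TopologicalSpace (TotalSpace model fiber)]
  [fiberBundle : FiberBundle model fiber]
  [vectorBundle : VectorBundle ℝ model fiber]

namespace RealVectorBundle

attribute [instance] modelNormedAddCommGroup modelNormedSpace modelFiniteDimensional
  fiberAddCommGroup fiberModule fiberTopologicalSpace totalTopologicalSpace fiberBundle
  vectorBundle

variable {B : Type} [TopologicalSpace B]

/-- The total space of a vector bundle. -/
abbrev Total (E : RealVectorBundle B) : Type := TotalSpace E.model E.fiber

/-- The map of total spaces induced by a family of linear maps of the fibres. -/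
def totalMap {E E' : RealVectorBundle B} (φ : ∀ b, E.fiber b →ₗ[ℝ] E'.fiber b) :
    E.Total → E'.Total :=
  fun p ↦ ⟨p.1, φ p.1 p.2⟩

/-- Two vector bundles over `B` are isomorphic if there are linear isomorphisms of their fibres
that define a homeomorphism of the total spaces. -/
def Iso (E E' : RealVectorBundle B) : Prop :=
  ∃ φ : ∀ b, E.fiber b ≃ₗ[ℝ] E'.fiber b,
    Continuous (totalMap fun b ↦ (φ b : E.fiber b →ₗ[ℝ] E'.fiber b)) ∧
    Continuous (totalMap fun b ↦ ((φ b).symm : E'.fiber b →ₗ[ℝ] E.fiber b))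

theorem Iso.refl (E : RealVectorBundle B) : Iso E E :=
  ⟨fun _ ↦ LinearEquiv.refl ℝ _, continuous_id, continuous_id⟩

theorem Iso.symm {E E' : RealVectorBundle B} : Iso E E' → Iso E' E := by
  rintro ⟨φ, h, h'⟩
  exact ⟨fun b ↦ (φ b).symm, h', h⟩

theorem Iso.trans {E E' E'' : RealVectorBundle B} : Iso E E' → Iso E' E'' → Iso E E'' := by
  rintro ⟨φ, h, h'⟩ ⟨ψ, k, k'⟩
  exact ⟨fun b ↦ (φ b).trans (ψ b), k.comp h, h'.comp k'⟩

instance setoid (B : Type) [TopologicalSpace B] : Setoid (RealVectorBundle B) where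
  r := Iso
  iseqv := ⟨Iso.refl, Iso.symm, Iso.trans⟩

/-- The trivial bundle `Θ(F)` with fibre `F`. -/
def trivial (B : Type) [TopologicalSpace B] (F : Type) [NormedAddCommGroup F] [NormedSpace ℝ F]
    [FiniteDimensional ℝ F] : RealVectorBundle B where
  model := F
  fiber := Bundle.Trivial B F

/-- The direct (Whitney) sum of two vector bundles. -/
def sum (E E' : RealVectorBundle B) : RealVectorBundle B where
  model := E.model × E'.model
  fiber := E.fiber ×ᵇ E'.fiber

def sumFst (E E' : RealVectorBundle B) : (E.sum E').Total → E.Total := fun p ↦ ⟨p.1, p.2.1⟩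

def sumSnd (E E' : RealVectorBundle B) : (E.sum E').Total → E'.Total := fun p ↦ ⟨p.1, p.2.2⟩

theorem continuous_sum_iff {X : Type} [TopologicalSpace X] {E E' : RealVectorBundle B}
    {f : X → (E.sum E').Total} :
    Continuous f ↔
      Continuous (fun x ↦ sumFst E E' (f x)) ∧ Continuous (fun x ↦ sumSnd E E' (f x)) := by
  have h := FiberBundle.Prod.isInducing_diag E.model E.fiber E'.model E'.fiber
  exact (h.continuous_iff (f := f)).trans continuous_prodMk

theorem continuous_sumFst (E E' : RealVectorBundle B) : Continuous (sumFst E E') :=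
  (continuous_sum_iff.1 continuous_id).1

theorem continuous_sumSnd (E E' : RealVectorBundle B) : Continuous (sumSnd E E') :=
  (continuous_sum_iff.1 continuous_id).2

theorem Iso.sum {E₁ E₁' E₂ E₂' : RealVectorBundle B} :
    Iso E₁ E₁' → Iso E₂ E₂' → Iso (E₁.sum E₂) (E₁'.sum E₂') := by
  rintro ⟨φ, h, h'⟩ ⟨ψ, k, k'⟩
  refine ⟨fun b ↦ (φ b).prodCongr (ψ b), ?_, ?_⟩
  · exact continuous_sum_iff.2
      ⟨h.comp (continuous_sumFst E₁ E₂), k.comp (continuous_sumSnd E₁ E₂)⟩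
  · exact continuous_sum_iff.2
      ⟨h'.comp (continuous_sumFst E₁' E₂'), k'.comp (continuous_sumSnd E₁' E₂')⟩

theorem sum_comm (E E' : RealVectorBundle B) : Iso (E.sum E') (E'.sum E) := by
  refine ⟨fun b ↦ LinearEquiv.prodComm ℝ (E.fiber b) (E'.fiber b), ?_, ?_⟩
  · exact continuous_sum_iff.2 ⟨continuous_sumSnd E E', continuous_sumFst E E'⟩
  · exact continuous_sum_iff.2 ⟨continuous_sumSnd E' E, continuous_sumFst E' E⟩

theorem sum_assoc (E E' E'' : RealVectorBundle B) :
    Iso ((E.sum E').sum E'') (E.sum (E'.sum E'')) := by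
  refine ⟨fun b ↦ LinearEquiv.prodAssoc ℝ (E.fiber b) (E'.fiber b) (E''.fiber b), ?_, ?_⟩
  · exact continuous_sum_iff.2
      ⟨(continuous_sumFst E E').comp (continuous_sumFst _ _),
        continuous_sum_iff.2
          ⟨(continuous_sumSnd E E').comp (continuous_sumFst _ _), continuous_sumSnd _ _⟩⟩
  · exact continuous_sum_iff.2
      ⟨continuous_sum_iff.2
          ⟨continuous_sumFst _ _, (continuous_sumFst E' E'').comp (continuous_sumSnd _ _)⟩,
        (continuous_sumSnd E' E'').comp (continuous_sumSnd _ _)⟩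

theorem zero_sum (E : RealVectorBundle B) : Iso ((trivial B PUnit).sum E) E := by
  refine ⟨fun b ↦
    { toFun := fun p ↦ p.2
      invFun := fun v ↦ (PUnit.unit, v)
      map_add' := fun _ _ ↦ rfl
      map_smul' := fun _ _ ↦ rfl
      left_inv := fun _ ↦ rfl
      right_inv := fun _ ↦ rfl }, ?_, ?_⟩
  · exact continuous_sumSnd (trivial B PUnit) E
  · refine continuous_sum_iff.2 ⟨?_, continuous_id⟩
    exact (Trivialization.continuous_zeroSection ℝ (F := PUnit) (E := Bundle.Trivial B PUnit)).comp
      (FiberBundle.continuous_proj E.model E.fiber)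

end RealVectorBundle

/-- `Vect(B)`: isomorphism classes of real vector bundles over `B`. -/
def Vect (B : Type) [TopologicalSpace B] : Type 1 :=
  Quotient (RealVectorBundle.setoid B)

namespace Vect

variable {B : Type} [TopologicalSpace B]

/-- The isomorphism class of a vector bundle. -/
def mk (E : RealVectorBundle B) : Vect B := Quotient.mk (RealVectorBundle.setoid B) E

instance : Add (Vect B) :=
  ⟨Quotient.map₂ RealVectorBundle.sum fun _ _ h _ _ k ↦ RealVectorBundle.Iso.sum h k⟩

instance : Zero (Vect B) := ⟨mk (RealVectorBundle.trivial B PUnit)⟩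

theorem mk_add_mk (E E' : RealVectorBundle B) : mk E + mk E' = mk (E.sum E') := rfl

theorem zero_def : (0 : Vect B) = mk (RealVectorBundle.trivial B PUnit) := rfl

theorem mk_eq_mk {E E' : RealVectorBundle B} : mk E = mk E' ↔ E.Iso E' := Quotient.eq

theorem ind {p : Vect B → Prop} (h : ∀ E, p (mk E)) (x : Vect B) : p x := Quotient.ind h x

instance : AddCommMonoid (Vect B) where
  add_assoc x y z := by
    induction x using Vect.ind
    induction y using Vect.ind
    induction z using Vect.ind
    exact mk_eq_mk.2 (RealVectorBundle.sum_assoc _ _ _)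
  add_comm x y := by
    induction x using Vect.ind
    induction y using Vect.ind
    exact mk_eq_mk.2 (RealVectorBundle.sum_comm _ _)
  zero_add x := by
    induction x using Vect.ind
    exact mk_eq_mk.2 (RealVectorBundle.zero_sum _)
  add_zero x := by
    induction x using Vect.ind
    exact mk_eq_mk.2 ((RealVectorBundle.sum_comm _ _).trans (RealVectorBundle.zero_sum _))
  nsmul := nsmulRec

end Vect

/-- `KO(B)`: the Grothendieck group (group completion) of `Vect(B)`, for a connected base `B`. -/
abbrev KO (B : Type) [TopologicalSpace B] [ConnectedSpace B] : Type 1 :=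
  Algebra.GrothendieckAddGroup (Vect B)

/-- The class in `KO(B)` of an isomorphism class of bundles. -/
def KO.of {B : Type} [TopologicalSpace B] [ConnectedSpace B] (x : Vect B) : KO B :=
  Algebra.GrothendieckAddGroup.of x

/-! ### Families of subspaces as vector bundles -/

section Subspaces

variable {B : Type} [TopologicalSpace B] {X : Type} [NormedAddCommGroup X] [NormedSpace ℝ X]

/-- The bundle `E` is isomorphic to the family of subspaces `W b ⊆ X`, whose total space
`⋃ b, {b} × W b` carries the subspace topology of `B × X`. -/
def RealVectorBundle.Represents (E : RealVectorBundle B) (W : B → Submodule ℝ X) : Prop :=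
  ∃ φ : ∀ b, E.fiber b ≃ₗ[ℝ] W b, IsEmbedding fun p : E.Total ↦ (p.1, (φ p.1 p.2 : X))

/-- The family of subspaces `W b ⊆ X` is a vector bundle over `B`, its total space
`⋃ b, {b} × W b` carrying the subspace topology of `B × X`. -/
def IsBundleFamily (W : B → Submodule ℝ X) : Prop :=
  ∃ E : RealVectorBundle B, E.Represents W

/-- The isomorphism class of the vector bundle formed by a family of subspaces. -/
def IsBundleFamily.toVect {W : B → Submodule ℝ X} (h : IsBundleFamily W) : Vect B :=
  Vect.mk h.choose

theorem RealVectorBundle.Represents.iso {E E' : RealVectorBundle B} {W : B → Submodule ℝ X}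
    (h : E.Represents W) (h' : E'.Represents W) : E.Iso E' := by
  obtain ⟨φ, hφ⟩ := h
  obtain ⟨ψ, hψ⟩ := h'
  refine ⟨fun b ↦ (φ b).trans (ψ b).symm, ?_, ?_⟩
  · rw [hψ.continuous_iff]
    convert hφ.continuous using 2 with p
    exact Prod.ext rfl (congrArg Subtype.val (LinearEquiv.apply_symm_apply _ _))
  · rw [hφ.continuous_iff]
    convert hψ.continuous using 2 with p
    exact Prod.ext rfl (congrArg Subtype.val (LinearEquiv.apply_symm_apply _ _))

theorem IsBundleFamily.toVect_eq {W : B → Submodule ℝ X} (h : IsBundleFamily W)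
    {E : RealVectorBundle B} (hE : E.Represents W) : h.toVect = Vect.mk E :=
  Vect.mk_eq_mk.2 (h.choose_spec.iso hE)

end Subspaces

/-! ### The index and the index bundle -/

section Index

variable {X Y : Type} [NormedAddCommGroup X] [NormedSpace ℝ X]
  [NormedAddCommGroup Y] [NormedSpace ℝ Y]

/-- `ind T = dim Ker T - dim Coker T`; meaningful for a Fredholm operator `T`. -/
def fredholmIndex (T : X →L[ℝ] Y) : ℤ :=
  (Module.finrank ℝ T.ker : ℤ) - (Module.finrank ℝ (Y ⧸ T.range) : ℤ)

variable {B : Type} [TopologicalSpace B] [ConnectedSpace B]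

/-- The element `η` of `KO(B)` is the index bundle of the family `L`: the family is a norm
continuous family of Fredholm operators, some finite dimensional `V ⊆ Y` is transversal to it,
i.e. `Im L_b + V = Y` for all `b`, and for every such `V` the subspaces
`E_b = L_b⁻¹(V)` form a vector bundle `E` with `η = [E] - [Θ(V)]`. -/
structure IsIndexBundle (L : B → X →L[ℝ] Y) (η : KO B) : Prop where
  continuous : Continuous L
  isFredholm : ∀ b, (L b).IsFredholm
  exists_transversal :
    ∃ V : Submodule ℝ Y, FiniteDimensional ℝ V ∧ ∀ b, (L b).range ⊔ V = ⊤
  eq_of_transversal : ∀ (V : Submodule ℝ Y) [FiniteDimensional ℝ V],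
    (∀ b, (L b).range ⊔ V = ⊤) →
      ∃ hE : IsBundleFamily fun b ↦ V.comap (L b : X →ₗ[ℝ] Y),
        η = KO.of hE.toVect - KO.of (Vect.mk (RealVectorBundle.trivial B V))

theorem IsIndexBundle.unique {L : B → X →L[ℝ] Y} {η η' : KO B}
    (h : IsIndexBundle L η) (h' : IsIndexBundle L η') : η = η' := by
  obtain ⟨V, hV, hL⟩ := h.exists_transversal
  obtain ⟨_, e⟩ := h.eq_of_transversal V hL
  obtain ⟨_, e'⟩ := h'.eq_of_transversal V hL
  rw [e, e']

end Index

/-! ### Hyperbolic matrices and stable subspaces -/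

section Hyperbolic

variable {N : ℕ}

/-- A real matrix with no complex eigenvalue of modulus one. -/
def IsHyperbolic (M : Matrix (Fin N) (Fin N) ℝ) : Prop :=
  ∀ z ∈ spectrum ℂ (M.map (fun t : ℝ ↦ (t : ℂ))), ‖z‖ ≠ 1

/-- The inclusion of `ℝ^N` in `ℂ^N`. -/
def complexify (N : ℕ) : EuclideanSpace ℝ (Fin N) →ₗ[ℝ] (Fin N → ℂ) where
  toFun x i := (x i : ℂ)
  map_add' x y := by ext i; simp
  map_smul' c x := by ext i; simp

/-- The stable subspace `E^s(M)`: the real vectors in the sum of the generalized eigenspaces in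
`ℂ^N` of the eigenvalues of modulus less than one. -/
def stableSubspace (M : Matrix (Fin N) (Fin N) ℝ) : Submodule ℝ (EuclideanSpace ℝ (Fin N)) :=
  ((⨆ z : ℂ, ⨆ _ : ‖z‖ < 1, Module.End.maxGenEigenspace
    (Matrix.toLin' (M.map (fun t : ℝ ↦ (t : ℂ)))) z).restrictScalars ℝ).comap (complexify N)

end Hyperbolic

/-! ### The operators on `c(ℝ^N)` -/

/-- `c(ℝ^N)`: the Banach space of sequences `x : ℤ → ℝ^N` with `x_n → 0` as `|n| → ∞`, with the
supremum norm. -/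
abbrev SeqSpace (N : ℕ) : Type := C₀(ℤ, EuclideanSpace ℝ (Fin N))

section Operators

variable {N : ℕ}

theorem SeqSpace.norm_apply_le (x : SeqSpace N) (n : ℤ) : ‖x n‖ ≤ ‖x‖ :=
  x.toBCF.norm_coe_le_norm n

theorem SeqSpace.norm_le {x : SeqSpace N} {C : ℝ} (hC : 0 ≤ C) (h : ∀ n, ‖x n‖ ≤ C) : ‖x‖ ≤ C :=
  (BoundedContinuousFunction.norm_le (f := x.toBCF) hC).2 h

/-- The shift `(S x)_n = x_{n+1}`. -/
def shiftOp (N : ℕ) : SeqSpace N →L[ℝ] SeqSpace N :=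
  LinearMap.mkContinuous
    { toFun := fun x ↦
        { toFun := fun n ↦ x (n + 1)
          continuous_toFun := continuous_of_discreteTopology
          zero_at_infty' := x.zero_at_infty'.comp
            (Homeomorph.addRight (1 : ℤ)).isClosedEmbedding.tendsto_cocompact }
      map_add' := fun _ _ ↦ rfl
      map_smul' := fun _ _ ↦ rfl }
    1 fun x ↦ by
      rw [one_mul]
      exact SeqSpace.norm_le (norm_nonneg x) fun n ↦ x.norm_apply_le (n + 1)

/-- A sequence of matrices is bounded. -/
def IsBoundedSeq (a : ℤ → Matrix (Fin N) (Fin N) ℝ) : Prop :=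
  ∃ C : ℝ, ∀ n, ‖Matrix.toEuclideanCLM (n := Fin N) (𝕜 := ℝ) (a n)‖ ≤ C

/-- The operator `(A x)_n = a_n x_n` of a bounded sequence of matrices. -/
def multOp (a : ℤ → Matrix (Fin N) (Fin N) ℝ) (ha : IsBoundedSeq a) :
    SeqSpace N →L[ℝ] SeqSpace N :=
  LinearMap.mkContinuous
    { toFun := fun x ↦
        { toFun := fun n ↦ Matrix.toEuclideanCLM (n := Fin N) (𝕜 := ℝ) (a n) (x n)
          continuous_toFun := continuous_of_discreteTopology
          zero_at_infty' := by
            refine squeeze_zero_norm (a := fun n ↦ ha.choose * ‖x n‖)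
              (fun n ↦ ContinuousLinearMap.le_of_opNorm_le _ (ha.choose_spec n) _) ?_
            simpa using x.zero_at_infty'.norm.const_mul ha.choose }
      map_add' := fun x y ↦ by ext1 n; simp
      map_smul' := fun c x ↦ by ext1 n; simp }
    ha.choose fun x ↦ by
      have h0 : 0 ≤ ha.choose := (norm_nonneg _).trans (ha.choose_spec 0)
      refine SeqSpace.norm_le (mul_nonneg h0 (norm_nonneg x)) fun n ↦ ?_
      exact (ContinuousLinearMap.le_of_opNorm_le _ (ha.choose_spec n) _).trans
        (mul_le_mul_of_nonneg_left (x.norm_apply_le n) h0)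

/-- The operator `L = S - A` of the linear difference equation `x_{n+1} = a_n x_n`. -/
def differenceOp (a : ℤ → Matrix (Fin N) (Fin N) ℝ) (ha : IsBoundedSeq a) :
    SeqSpace N →L[ℝ] SeqSpace N :=
  shiftOp N - multOp a ha

theorem differenceOp_apply (a : ℤ → Matrix (Fin N) (Fin N) ℝ) (ha : IsBoundedSeq a)
    (x : SeqSpace N) (n : ℤ) :
    differenceOp a ha x n = x (n + 1) - WithLp.toLp 2 ((a n).mulVec (x n)) := rfl

theorem IsBoundedSeq.of_tendsto {a : ℤ → Matrix (Fin N) (Fin N) ℝ}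
    {p m : Matrix (Fin N) (Fin N) ℝ} (hp : Tendsto a atTop (𝓝 p)) (hm : Tendsto a atBot (𝓝 m)) :
    IsBoundedSeq a := by
  have hc : Continuous fun M : Matrix (Fin N) (Fin N) ℝ ↦
      ‖Matrix.toEuclideanCLM (n := Fin N) (𝕜 := ℝ) M‖ :=
    (LinearMap.continuous_of_finiteDimensional
      ((Matrix.toEuclideanCLM (n := Fin N) (𝕜 := ℝ)).toAlgEquiv.toLinearMap)).norm
  obtain ⟨C₁, h1⟩ := ((hc.tendsto p).comp hp).isBoundedUnder_le
  obtain ⟨C₂, h2⟩ := ((hc.tendsto m).comp hm).isBoundedUnder_le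
  rw [eventually_map] at h1 h2
  have h3 : IsBoundedUnder (· ≤ ·) cofinite
      ((fun M : Matrix (Fin N) (Fin N) ℝ ↦
        ‖Matrix.toEuclideanCLM (n := Fin N) (𝕜 := ℝ) M‖) ∘ a) := by
    refine ⟨max C₁ C₂, ?_⟩
    rw [eventually_map, Int.cofinite_eq]
    exact eventually_sup.2 ⟨h2.mono fun _ h ↦ h.trans (le_max_right _ _),
      h1.mono fun _ h ↦ h.trans (le_max_left _ _)⟩
  obtain ⟨C, hC⟩ := h3.bddAbove_range_of_cofinite
  exact ⟨C, fun n ↦ hC ⟨n, rfl⟩⟩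

end Operators

end

/-! The idea is to deform the family to one whose coefficients are constant on each half-line, where
the difference equation can be solved explicitly. Write P and M for the limit matrices at +∞ and -∞.

For a hyperbolic matrix A with constant coefficients, S - A is invertible (`isUnit_shift_sub_map`):
the spectrum of S lies on the unit circle, that of A avoids it, and the two operators commute.
Solving (S - A)x = δ₋₁v and evaluating at 0 gives the projection onto E^s(A), which is therefore
continuous in A. Its range is a vector bundle, and so is its kernel, the unstable subspace E^u(A).

Let T be the operator with coefficient P at n ≥ 0 and M at n < 0, and let V be the sequences
supported at -1. Modulo V the equation that couples the half-lines disappears, so T is surjective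
modulo V, and T⁻¹(V) consists of pairs of decaying half-line solutions; boundary values identify it
with E^s(P) ⊕ E^u(M) (`familyIso_comap_stepOp`). Since V ≅ ℝ^N = E^s(M) ⊕ E^u(M), the unstable part
cancels and Ind T = [E^s(P)] - [E^s(M)].

The difference L - T splits into a tail and a finite block. By uniform convergence the tail is small
in norm, and a Neumann series shows that it changes the preimage of V only by an isomorphism of
bundles (`familyIso_comap_of_range_eq`). The block takes values in a fixed finite dimensional space,
and such a change does not even move the preimage of that space (`IsIndexBundle.congr_of_sub_mem`).
Hence Ind L = Ind T, and the numerical index is the virtual rank of this class.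

The tool throughout is a right inverse R of L modulo V that vanishes on V: then 1 - RL is a
projection onto L⁻¹(V). -/

noncomputable section

set_option synthInstance.maxHeartbeats 400000

/-! ### Isomorphic families of subspaces and their classes -/

section Families

variable {B : Type} [TopologicalSpace B] {X X' : Type}
  [NormedAddCommGroup X] [NormedSpace ℝ X] [NormedAddCommGroup X'] [NormedSpace ℝ X']

/-- Two families of subspaces are isomorphic through restrictions of norm continuous families of
operators of the ambient spaces. -/
def FamilyIso (W : B → Submodule ℝ X) (W' : B → Submodule ℝ X') : Prop :=
  ∃ (T : B → X →L[ℝ] X') (S : B → X' →L[ℝ] X), Continuous T ∧ Continuous S ∧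
    ∀ b, (∀ x ∈ W b, T b x ∈ W' b ∧ S b (T b x) = x) ∧
      ∀ y ∈ W' b, S b y ∈ W b ∧ T b (S b y) = y

theorem FamilyIso.symm {W : B → Submodule ℝ X} {W' : B → Submodule ℝ X'} :
    FamilyIso W W' → FamilyIso W' W := by
  rintro ⟨T, S, hT, hS, h⟩
  exact ⟨S, T, hS, hT, fun b ↦ ⟨(h b).2, (h b).1⟩⟩

theorem RealVectorBundle.Represents.congr {E : RealVectorBundle B} {W : B → Submodule ℝ X}
    {W' : B → Submodule ℝ X'} (hE : E.Represents W) (h : FamilyIso W W') : E.Represents W' := by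
  obtain ⟨φ, hφ⟩ := hE
  obtain ⟨T, S, hT, hS, h⟩ := h
  let ψ : ∀ b, W b ≃ₗ[ℝ] W' b := fun b ↦
    { toFun := fun x ↦ ⟨T b x, ((h b).1 x x.2).1⟩
      invFun := fun y ↦ ⟨S b y, ((h b).2 y y.2).1⟩
      map_add' := fun x y ↦ Subtype.ext (by simp)
      map_smul' := fun c x ↦ Subtype.ext (by simp)
      left_inv := fun x ↦ Subtype.ext ((h b).1 x x.2).2
      right_inv := fun y ↦ Subtype.ext ((h b).2 y y.2).2 }
  have hFT : Continuous fun q : B × X ↦ (q.1, T q.1 q.2) :=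
    continuous_fst.prodMk ((hT.comp continuous_fst).clm_apply continuous_snd)
  have hFS : Continuous fun q : B × X' ↦ (q.1, S q.1 q.2) :=
    continuous_fst.prodMk ((hS.comp continuous_fst).clm_apply continuous_snd)
  -- Composing the new map with the continuous map induced by `S` gives back the embedding `hφ`, so
  -- the new map is itself an embedding.
  refine ⟨fun b ↦ (φ b).trans (ψ b), IsEmbedding.of_comp (hFT.comp hφ.continuous) hFS ?_⟩
  convert hφ using 2 with p
  exact Prod.ext rfl ((h p.1).1 _ (φ p.1 p.2).2).2

/-- The isomorphism class `x` is the class of the vector bundle formed by the family `W`. -/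
def HasClass (W : B → Submodule ℝ X) (x : Vect B) : Prop :=
  ∃ E : RealVectorBundle B, E.Represents W ∧ Vect.mk E = x

theorem HasClass.congr {W : B → Submodule ℝ X} {W' : B → Submodule ℝ X'} {x : Vect B}
    (hx : HasClass W x) (h : FamilyIso W W') : HasClass W' x := by
  obtain ⟨E, hE, rfl⟩ := hx
  exact ⟨E, hE.congr h, rfl⟩

theorem HasClass.unique {W : B → Submodule ℝ X} {x y : Vect B}
    (hx : HasClass W x) (hy : HasClass W y) : x = y := by
  obtain ⟨E, hE, rfl⟩ := hx
  obtain ⟨E', hE', rfl⟩ := hy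
  exact Vect.mk_eq_mk.2 (hE.iso hE')

theorem IsBundleFamily.hasClass {W : B → Submodule ℝ X} (h : IsBundleFamily W) :
    HasClass W h.toVect :=
  ⟨h.choose, h.choose_spec, rfl⟩

theorem HasClass.isBundleFamily {W : B → Submodule ℝ X} {x : Vect B} (h : HasClass W x) :
    IsBundleFamily W :=
  ⟨h.choose, h.choose_spec.1⟩

theorem HasClass.prod {W : B → Submodule ℝ X} {W' : B → Submodule ℝ X'} {x x' : Vect B}
    (hx : HasClass W x) (hx' : HasClass W' x') :
    HasClass (fun b ↦ (W b).prod (W' b)) (x + x') := by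
  obtain ⟨E, ⟨φ, hφ⟩, rfl⟩ := hx
  obtain ⟨E', ⟨ψ, hψ⟩, rfl⟩ := hx'
  let χ : ∀ b, (E.sum E').fiber b ≃ₗ[ℝ] (W b).prod (W' b) := fun b ↦
    { toFun := fun v ↦ ⟨(φ b v.1, ψ b v.2), (φ b v.1).2, (ψ b v.2).2⟩
      invFun := fun w ↦ ((φ b).symm ⟨w.1.1, w.2.1⟩, (ψ b).symm ⟨w.1.2, w.2.2⟩)
      map_add' := fun v w ↦ Subtype.ext (Prod.ext
        (congrArg Subtype.val (map_add (φ b) v.1 w.1)) (congrArg Subtype.val (map_add (ψ b) v.2 w.2)))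
      map_smul' := fun r v ↦ Subtype.ext (Prod.ext
        (congrArg Subtype.val (map_smul (φ b) r v.1)) (congrArg Subtype.val (map_smul (ψ b) r v.2)))
      left_inv := fun v ↦ Prod.ext ((φ b).symm_apply_apply v.1) ((ψ b).symm_apply_apply v.2)
      right_inv := fun w ↦ Subtype.ext (Prod.ext
        (congrArg Subtype.val ((φ b).apply_symm_apply ⟨w.1.1, w.2.1⟩))
        (congrArg Subtype.val ((ψ b).apply_symm_apply ⟨w.1.2, w.2.2⟩))) }
  have hd : IsEmbedding fun p : (E.sum E').Total ↦
      (RealVectorBundle.sumFst E E' p, RealVectorBundle.sumSnd E E' p) := by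
    refine ⟨FiberBundle.Prod.isInducing_diag E.model E.fiber E'.model E'.fiber, ?_⟩
    rintro ⟨b, v⟩ ⟨b', v'⟩ hvv
    obtain ⟨h1, h2⟩ := Prod.ext_iff.1 hvv
    simp only [RealVectorBundle.sumFst, RealVectorBundle.sumSnd] at h1 h2
    obtain ⟨rfl, h1⟩ := TotalSpace.mk.inj h1
    have h2 := (TotalSpace.mk.inj h2).2
    congr 1
    exact Prod.ext (eq_of_heq h1) (eq_of_heq h2)
  have hg := (hφ.prodMap hψ).comp hd
  let g : B × X × X' → (B × X) × B × X' := fun q ↦ ((q.1, q.2.1), (q.1, q.2.2))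
  let k : (B × X) × B × X' → B × X × X' := fun q ↦ (q.1.1, q.1.2, q.2.2)
  refine ⟨E.sum E', ⟨χ, ?_⟩, rfl⟩
  -- Duplicating the base point by `g` gives the embedding into the product of the two total spaces;
  -- `k` forgets the duplicate and yields continuity.
  refine IsEmbedding.of_comp (g := g) ?_ (by fun_prop) hg
  exact (show Continuous k by fun_prop).comp hg.continuous

theorem hasClass_const (V : Submodule ℝ X) [FiniteDimensional ℝ V] :
    HasClass (fun _ : B ↦ V) (Vect.mk (RealVectorBundle.trivial B V)) := by
  refine ⟨_, ⟨fun _ ↦ LinearEquiv.refl ℝ V, ?_⟩, rfl⟩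
  exact (IsEmbedding.id.prodMap IsEmbedding.subtypeVal).comp
    (Bundle.Trivial.homeomorphProd B V).isEmbedding

/-- A fibre of a vector bundle is isomorphic to the model fibre. -/
def RealVectorBundle.fiberModelEquiv (E : RealVectorBundle B) (b : B) : E.fiber b ≃ₗ[ℝ] E.model :=
  (trivializationAt E.model E.fiber b).linearEquivAt ℝ b
    (FiberBundle.mem_baseSet_trivializationAt' b)

variable [ConnectedSpace B]

/-- The rank of the vector bundles in an isomorphism class. -/
def Vect.rank : Vect B →+ ℤ where
  toFun := Quotient.lift (fun E ↦ (Module.finrank ℝ E.model : ℤ)) (by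
    rintro E E' ⟨φ, -⟩
    let b : B := Classical.arbitrary B
    exact congrArg _
      ((E.fiberModelEquiv b).symm.trans ((φ b).trans (E'.fiberModelEquiv b))).finrank_eq)
  map_zero' := congrArg Nat.cast (Module.finrank_zero_of_subsingleton (R := ℝ) (M := PUnit))
  map_add' x y := by
    induction x using Vect.ind with | _ E
    induction y using Vect.ind with | _ E'
    exact (congrArg Nat.cast (Module.finrank_prod (R := ℝ) (M := E.model) (M' := E'.model))).trans
      (Nat.cast_add _ _)

theorem HasClass.rank_eq {W : B → Submodule ℝ X} {x : Vect B} (h : HasClass W x) (b : B) :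
    Vect.rank x = Module.finrank ℝ (W b) := by
  obtain ⟨E, ⟨φ, -⟩, rfl⟩ := h
  exact congrArg Nat.cast ((E.fiberModelEquiv b).symm.trans (φ b)).finrank_eq

/-- The virtual rank of a class in `KO(B)`. -/
def KO.rank : KO B →+ ℤ := Algebra.GrothendieckAddGroup.lift Vect.rank

theorem KO.rank_of (x : Vect B) : KO.rank (KO.of x) = Vect.rank x :=
  DFunLike.congr_fun (Algebra.GrothendieckAddGroup.lift.left_inv Vect.rank) x

theorem KO.of_add (x y : Vect B) : KO.of (x + y) = KO.of x + KO.of y :=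
  map_add Algebra.GrothendieckAddGroup.of x y

end Families

/-! ### Continuous families of projections -/

section Projections

variable {B : Type} [TopologicalSpace B] {X : Type} [NormedAddCommGroup X] [NormedSpace ℝ X]

/-- A norm continuous family of projections onto the subspaces `W b`. -/
structure IsProjectionFamily (P : B → X →L[ℝ] X) (W : B → Submodule ℝ X) : Prop where
  continuous : Continuous P
  apply_mem : ∀ b x, P b x ∈ W b
  apply_eq : ∀ b, ∀ x ∈ W b, P b x = x

/-- The canonical operator that intertwines two projections. -/
def projIntertwiner (P Q : X →L[ℝ] X) : X →L[ℝ] X := P * Q + (1 - P) * (1 - Q)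

theorem projIntertwiner_self {P : X →L[ℝ] X} (hP : P * P = P) : projIntertwiner P P = 1 := by
  simp only [projIntertwiner, mul_sub, sub_mul, hP]; simp

/-- Both sides equal PQ. As the intertwiner is 1 when P = Q, it stays invertible for Q near P and
then carries the range of Q onto that of P: this is the local triviality of a continuous family of
projections. -/
theorem mul_projIntertwiner {P Q : X →L[ℝ] X} (hP : P * P = P) (hQ : Q * Q = Q) :
    P * projIntertwiner P Q = projIntertwiner P Q * Q := by
  simp only [projIntertwiner, mul_add, add_mul, mul_sub, sub_mul, hP, mul_assoc, hQ, ← mul_assoc P P]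
  simp

variable {P : B → X →L[ℝ] X} {W : B → Submodule ℝ X}

namespace IsProjectionFamily

theorem mul_self (h : IsProjectionFamily P W) (b : B) : P b * P b = P b := by
  ext x
  exact h.apply_eq b _ (h.apply_mem b x)

/-- The open set of points over which the family is trivialized by the intertwiner with the
projection at `c`. -/
def baseSet (P : B → X →L[ℝ] X) (c : B) : Set B := {b | IsUnit (projIntertwiner (P c) (P b))}

theorem continuous_intertwiner (h : IsProjectionFamily P W) (c : B) :
    Continuous fun b ↦ projIntertwiner (P c) (P b) := by
  have := h.continuous
  unfold projIntertwiner
  fun_prop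

theorem isOpen_baseSet [CompleteSpace X] (h : IsProjectionFamily P W) (c : B) :
    IsOpen (baseSet P c) :=
  Units.isOpen.preimage (h.continuous_intertwiner c)

theorem mem_baseSet (h : IsProjectionFamily P W) (c : B) : c ∈ baseSet P c := by
  simp [baseSet, projIntertwiner_self (h.mul_self c)]

theorem continuousOn_inverse [CompleteSpace X] (h : IsProjectionFamily P W) (c : B) :
    ContinuousOn (fun b ↦ Ring.inverse (projIntertwiner (P c) (P b))) (baseSet P c) := by
  intro b hb
  refine ContinuousAt.continuousWithinAt ?_
  have h1 := NormedRing.inverse_continuousAt hb.unit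
  exact ContinuousAt.comp (f := fun b ↦ projIntertwiner (P c) (P b)) (g := Ring.inverse) h1
    (h.continuous_intertwiner c).continuousAt

theorem intertwiner_mem (h : IsProjectionFamily P W) (c b : B) {x : X} (hx : x ∈ W b) :
    projIntertwiner (P c) (P b) x ∈ W c := by
  have h1 := DFunLike.congr_fun (mul_projIntertwiner (h.mul_self c) (h.mul_self b)) x
  simp only [mul_apply_eq_comp, h.apply_eq b x hx] at h1
  rw [← h1]
  exact h.apply_mem c _

theorem inverse_mem (h : IsProjectionFamily P W) {c b : B} (hb : b ∈ baseSet P c) {x : X}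
    (hx : x ∈ W c) : Ring.inverse (projIntertwiner (P c) (P b)) x ∈ W b := by
  have h1 := mul_projIntertwiner (h.mul_self c) (h.mul_self b)
  set J := projIntertwiner (P c) (P b) with hJ
  have h2 : Ring.inverse J * P c = P b * Ring.inverse J := by
    calc Ring.inverse J * P c = Ring.inverse J * (P c * J) * Ring.inverse J := by
          rw [mul_assoc, mul_assoc, Ring.mul_inverse_cancel _ hb, mul_one]
      _ = P b * Ring.inverse J := by
          rw [h1, ← mul_assoc, Ring.inverse_mul_cancel _ hb, one_mul]
  have h3 := DFunLike.congr_fun h2 x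
  simp only [mul_apply_eq_comp, h.apply_eq c x hx] at h3
  rw [h3]
  exact h.apply_mem b _

omit [TopologicalSpace B] in
theorem inverse_apply {c b : B} (hb : b ∈ baseSet P c) (x : X) :
    Ring.inverse (projIntertwiner (P c) (P b)) (projIntertwiner (P c) (P b) x) = x := by
  have := DFunLike.congr_fun (Ring.inverse_mul_cancel _ hb) x
  simpa using this

omit [TopologicalSpace B] in
theorem apply_inverse {c b : B} (hb : b ∈ baseSet P c) (x : X) :
    projIntertwiner (P c) (P b) (Ring.inverse (projIntertwiner (P c) (P b)) x) = x := by
  have := DFunLike.congr_fun (Ring.mul_inverse_cancel _ hb) x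
  simpa using this

/-- The isomorphism of the fibre at `b` with the fibre at `c`. -/
def fiberEquiv (h : IsProjectionFamily P W) {c b : B} (hb : b ∈ baseSet P c) : W b ≃ₗ[ℝ] W c where
  toFun x := ⟨projIntertwiner (P c) (P b) x, h.intertwiner_mem c b x.2⟩
  invFun x := ⟨Ring.inverse (projIntertwiner (P c) (P b)) x, h.inverse_mem hb x.2⟩
  map_add' x y := Subtype.ext (by simp)
  map_smul' r x := Subtype.ext (by simp)
  left_inv x := Subtype.ext (inverse_apply hb x)
  right_inv x := Subtype.ext (apply_inverse hb x)

theorem finrank_eq [CompleteSpace X] [ConnectedSpace B] (h : IsProjectionFamily P W) (b c : B) :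
    Module.finrank ℝ (W b) = Module.finrank ℝ (W c) := by
  have : IsLocallyConstant fun b ↦ Module.finrank ℝ (W b) := by
    refine (IsLocallyConstant.iff_exists_open _).2 fun c ↦
      ⟨baseSet P c, h.isOpen_baseSet c, h.mem_baseSet c, fun b hb ↦ ?_⟩
    exact (h.fiberEquiv hb).finrank_eq
  exact this.apply_eq_of_preconnectedSpace b c

end IsProjectionFamily

/-- The topology of the total space of a family of subspaces. -/
@[reducible]
def familyTopology (F : Type) (W : B → Submodule ℝ X) :
    TopologicalSpace (TotalSpace F fun b ↦ W b) :=
  .induced (fun p ↦ (p.1, (p.2 : X))) inferInstance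

theorem isEmbedding_familyTopology (F : Type) (W : B → Submodule ℝ X) :
    let := familyTopology F W
    IsEmbedding fun p : TotalSpace F fun b ↦ W b ↦ (p.1, (p.2 : X)) := by
  let := familyTopology F W
  refine ⟨⟨rfl⟩, ?_⟩
  rintro ⟨b, x⟩ ⟨b', x'⟩ hxx
  obtain ⟨rfl, h2⟩ := Prod.ext_iff.1 hxx
  congr
  exact Subtype.ext h2

/-- The local trivialization of the family near `c`. -/
def IsProjectionFamily.trivialization [CompleteSpace X] (h : IsProjectionFamily P W) {F : Type}
    [NormedAddCommGroup F] [NormedSpace ℝ F] (c : B) (e : W c ≃L[ℝ] F) :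
    letI := familyTopology F W
    Trivialization F (π F fun b ↦ W b) :=
  letI := familyTopology F W
  { toFun := fun p ↦ (p.1, e ⟨projIntertwiner (P c) (P p.1) p.2, h.intertwiner_mem c p.1 p.2.2⟩)
    -- Applying `P q.1` puts the vector in the fibre for every `q`; over the base set the vector is
    -- already there and is not changed.
    invFun := fun q ↦ ⟨q.1, ⟨P q.1 (Ring.inverse (projIntertwiner (P c) (P q.1)) (e.symm q.2)),
      h.apply_mem _ _⟩⟩
    source := π F (fun b ↦ W b) ⁻¹' baseSet P c
    target := baseSet P c ×ˢ Set.univ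
    map_source' := fun p hp ↦ ⟨hp, trivial⟩
    map_target' := fun q hq ↦ hq.1
    left_inv' := by
      rintro ⟨b, x⟩ hb
      refine (isEmbedding_familyTopology F W).injective (Prod.ext rfl ?_)
      simp only [ContinuousLinearEquiv.symm_apply_apply]
      rw [inverse_apply hb, h.apply_eq b x x.2]
    right_inv' := by
      rintro ⟨b, v⟩ ⟨hb, -⟩
      refine Prod.ext rfl ?_
      refine Eq.trans (congrArg e (Subtype.ext ?_)) (e.apply_symm_apply v)
      dsimp only
      rw [h.apply_eq b _ (h.inverse_mem hb (e.symm v).2), apply_inverse hb]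
    open_source := by
      refine (h.isOpen_baseSet c).preimage ?_
      exact continuous_fst.comp (isEmbedding_familyTopology F W).continuous
    open_target := (h.isOpen_baseSet c).prod isOpen_univ
    continuousOn_toFun := by
      refine Continuous.continuousOn ?_
      have h1 := (isEmbedding_familyTopology F W).continuous
      have h2 := continuous_fst.comp h1
      refine h2.prodMk (e.continuous.comp (Continuous.subtype_mk ?_ _))
      exact ((h.continuous_intertwiner c).comp h2).clm_apply (continuous_snd.comp h1)
    continuousOn_invFun := by
      rw [(isEmbedding_familyTopology F W).continuousOn_iff]
      refine continuousOn_fst.prodMk ?_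
      refine (h.continuous.comp continuous_fst).continuousOn.clm_apply ?_
      refine ((h.continuousOn_inverse c).comp continuousOn_fst fun q hq ↦ hq.1).clm_apply ?_
      exact (continuous_subtype_val.comp (e.symm.continuous.comp continuous_snd)).continuousOn
    baseSet := baseSet P c
    open_baseSet := h.isOpen_baseSet c
    source_eq := rfl
    target_eq := rfl
    proj_toFun := fun _ _ ↦ rfl }

/-- Connectedness makes the rank constant, so that one model fibre serves all the local
trivializations by intertwiners. -/
theorem IsProjectionFamily.isBundleFamily [CompleteSpace X] [ConnectedSpace B]
    (h : IsProjectionFamily P W) (hW : ∀ b, FiniteDimensional ℝ (W b)) : IsBundleFamily W := by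
  let b₀ : B := Classical.arbitrary B
  let F := EuclideanSpace ℝ (Fin (Module.finrank ℝ (W b₀)))
  have he : ∀ c, Nonempty (W c ≃L[ℝ] F) := fun c ↦ by
    refine ⟨ContinuousLinearEquiv.ofFinrankEq ?_⟩
    rw [h.finrank_eq c b₀]; simp [F]
  let e := fun c ↦ (he c).some
  let := familyTopology F W
  let triv : B → Trivialization F (π F fun b ↦ W b) := fun c ↦ h.trivialization c (e c)
  have hlin : ∀ c, (triv c).IsLinear ℝ := fun c ↦ ⟨fun b _ ↦
    { map_add := fun x y ↦ by
        refine Eq.trans (congrArg (e c) (Subtype.ext ?_)) (map_add (e c) _ _)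
        simp
      map_smul := fun r x ↦ by
        refine Eq.trans (congrArg (e c) (Subtype.ext ?_)) (map_smul (e c) _ _)
        simp }⟩
  let fb : FiberBundle F fun b ↦ W b :=
    { totalSpaceMk_isInducing' := fun b ↦ by
        refine (IsInducing.of_comp_iff (isEmbedding_familyTopology F W).isInducing).1 ?_
        exact ((isEmbedding_prodMkRight b).comp IsEmbedding.subtypeVal).isInducing
      trivializationAtlas' := Set.range triv
      trivializationAt' := triv
      mem_baseSet_trivializationAt' := h.mem_baseSet
      trivialization_mem_atlas' := fun b ↦ ⟨b, rfl⟩ }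
  have vb : VectorBundle ℝ F fun b ↦ W b :=
    { trivialization_linear' := by
        rintro _ ⟨⟨c, rfl⟩⟩
        exact hlin c
      continuousOn_coordChange' := by
        rintro _ _ ⟨⟨c, rfl⟩⟩ ⟨⟨d, rfl⟩⟩
        have := hlin c
        have := hlin d
        -- The model fibre is finite dimensional, so norm continuity of the coordinate changes may
        -- be checked on each vector.
        refine continuousOn_clm_apply.2 fun y ↦ ?_
        have h1 : ContinuousOn (fun b ↦ (triv d ((triv c).toOpenPartialHomeomorph.symm (b, y))).2)
            ((triv c).baseSet ∩ (triv d).baseSet) := by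
          refine continuous_snd.comp_continuousOn ?_
          refine (triv d).continuousOn_toFun.comp
            ((triv c).continuousOn_invFun.comp (by fun_prop) fun b hb ↦ ?_) fun b hb ↦ ?_
          · exact ⟨hb.1, trivial⟩
          · exact hb.2
        refine h1.congr fun b hb ↦ ?_
        exact (triv c).coordChangeL_apply' (triv d) hb y }
  refine ⟨⟨F, fun b ↦ W b⟩, fun b ↦ LinearEquiv.refl ℝ (W b), ?_⟩
  exact isEmbedding_familyTopology F W

end Projections

/-! ### Right inverses modulo a transversal subspace -/

section RightInverses

variable {X Y : Type} [NormedAddCommGroup X] [NormedSpace ℝ X]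
  [NormedAddCommGroup Y] [NormedSpace ℝ Y]

/-- `R` is a right inverse of `L` modulo `V` and vanishes on `V`. -/
structure IsRightInverseMod (L : X →L[ℝ] Y) (V : Submodule ℝ Y) (R : Y →L[ℝ] X) : Prop where
  sub_mem : ∀ y, L (R y) - y ∈ V
  apply_eq_zero : ∀ v ∈ V, R v = 0

namespace IsRightInverseMod

variable {L L' : X →L[ℝ] Y} {V : Submodule ℝ Y} {R : Y →L[ℝ] X}

theorem comp_sub_mem (h : IsRightInverseMod L V R) (x : X) :
    x - R (L x) ∈ V.comap (L : X →ₗ[ℝ] Y) := by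
  have := V.neg_mem (h.sub_mem (L x))
  simpa using this

theorem comp_eq_zero (h : IsRightInverseMod L V R) {x : X}
    (hx : x ∈ V.comap (L : X →ₗ[ℝ] Y)) : R (L x) = 0 :=
  h.apply_eq_zero _ hx

theorem sup_eq_top (h : IsRightInverseMod L V R) : L.range ⊔ V = ⊤ := by
  refine eq_top_iff.2 fun y _ ↦ Submodule.mem_sup.2 ⟨L (R y), ⟨R y, rfl⟩, _,
    V.neg_mem (h.sub_mem y), by abel⟩

/-- A right inverse modulo `V` of a perturbation of `L`. -/
theorem perturb (h : IsRightInverseMod L V R) (hu : IsUnit (1 + (L' - L) ∘L R)) :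
    IsRightInverseMod L' V (R ∘L Ring.inverse (1 + (L' - L) ∘L R)) := by
  set M : Y →L[ℝ] Y := 1 + (L' - L) ∘L R with hM
  have h1 : ∀ y, M (Ring.inverse M y) = y := fun y ↦ by
    simpa using DFunLike.congr_fun (Ring.mul_inverse_cancel _ hu) y
  have h2 : ∀ y, Ring.inverse M (M y) = y := fun y ↦ by
    simpa using DFunLike.congr_fun (Ring.inverse_mul_cancel _ hu) y
  refine ⟨fun y ↦ ?_, fun v hv ↦ ?_⟩
  · have h3 := h.sub_mem (Ring.inverse M y)
    have h4 := h1 y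
    set z := Ring.inverse M y
    have h5 : M z = z + (L' (R z) - L (R z)) := by simp [hM]
    rw [ContinuousLinearMap.comp_apply]
    have h6 : L' (R z) - y = L (R z) - z := by
      rw [← h4, h5]
      abel
    rwa [h6]
  -- `R` vanishes on `V`, so `M` and its inverse are the identity there.
  · have h3 : M v = v := by simp [hM, h.apply_eq_zero v hv]
    have h4 := h2 v
    rw [h3] at h4
    rw [ContinuousLinearMap.comp_apply, h4, h.apply_eq_zero v hv]

/-- `R` is an inverse of `L` up to finite rank: LR - 1 has values in V, and RL - 1 has values in
L⁻¹(V). -/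
theorem isFredholm (h : IsRightInverseMod L V R) [FiniteDimensional ℝ V]
    (hV : FiniteDimensional ℝ (V.comap (L : X →ₗ[ℝ] Y))) : L.IsFredholm := by
  refine ContinuousLinearMap.IsFredholm.of_isQuasiInverse (v := R) ⟨?_, ?_⟩
  · refine LinearMap.FiniteRangeSetoid.equiv_iff_hasFiniteRange.2 ?_
    refine (Submodule.fg_iff_finiteDimensional _).2
      (Submodule.finiteDimensional_of_le (S₂ := V.comap (L : X →ₗ[ℝ] Y)) ?_)
    rintro _ ⟨x, rfl⟩
    have := (V.comap (L : X →ₗ[ℝ] Y)).neg_mem (h.comp_sub_mem x)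
    simpa using this
  · refine LinearMap.FiniteRangeSetoid.equiv_iff_hasFiniteRange.2 ?_
    refine (Submodule.fg_iff_finiteDimensional _).2
      (Submodule.finiteDimensional_of_le (S₂ := V) ?_)
    rintro _ ⟨x, rfl⟩
    exact h.sub_mem x

end IsRightInverseMod

theorem ContinuousLinearMap.IsFredholm.finiteDimensional_comap {L : X →L[ℝ] Y} (hL : L.IsFredholm)
    (V : Submodule ℝ Y) [FiniteDimensional ℝ V] :
    FiniteDimensional ℝ (V.comap (L : X →ₗ[ℝ] Y)) := by
  have := hL.finite_ker
  refine (Submodule.fg_iff_finiteDimensional _).1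
    (Submodule.fg_of_fg_map_of_fg_inf_ker (L : X →ₗ[ℝ] Y) ?_ ?_)
  · exact (Submodule.fg_iff_finiteDimensional _).2
      (Submodule.finiteDimensional_of_le (Submodule.map_comap_le _ V))
  · exact (Submodule.fg_iff_finiteDimensional _).2
      (Submodule.finiteDimensional_of_le (S₂ := L.ker) inf_le_right)

-- A quasi-inverse Q fails to be a right inverse only by the finite rank operator LQ - 1. On its
-- range, transversality allows a linear, hence continuous, correction modulo V. Precomposing with a
-- projection that kills V enforces the vanishing on V.
open scoped LinearMap.FiniteRangeSetoid in
theorem ContinuousLinearMap.IsFredholm.exists_isRightInverseMod {L : X →L[ℝ] Y}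
    (hL : L.IsFredholm) (V : Submodule ℝ Y) [FiniteDimensional ℝ V] (hV : L.range ⊔ V = ⊤) :
    ∃ R, IsRightInverseMod L V R := by
  obtain ⟨Q, hQ⟩ := hL.exists_isQuasiInverse
  have hfin : FiniteDimensional ℝ (L ∘L Q - ContinuousLinearMap.id ℝ Y).range :=
    (Submodule.fg_iff_finiteDimensional _).1
      (LinearMap.FiniteRangeSetoid.equiv_iff_hasFiniteRange.1 hQ.2)
  obtain ⟨p, hp⟩ := Submodule.ClosedComplemented.of_finiteDimensional V
  have hsurj : LinearMap.range ((L : X →ₗ[ℝ] Y).coprod V.subtype) = ⊤ := by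
    rw [LinearMap.range_coprod, Submodule.range_subtype]
    exact hV
  obtain ⟨s, hs⟩ := LinearMap.exists_rightInverse_of_surjective _ hsurj
  let F : Y →L[ℝ] Y := L ∘L Q - ContinuousLinearMap.id ℝ Y
  let c : F.range →L[ℝ] X := LinearMap.toContinuousLinearMap
    ((LinearMap.fst ℝ X V ∘ₗ s) ∘ₗ F.range.subtype)
  have hc : ∀ w : F.range, L (c w) - w ∈ V := fun w ↦ by
    have h1 := LinearMap.congr_fun hs (w : Y)
    have h2 : L (c w) + (s (w : Y)).2 = w := h1
    rw [← h2]
    simp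
  let F' : Y →L[ℝ] F.range := F.codRestrict F.range fun y ↦ ⟨y, rfl⟩
  let R : Y →L[ℝ] X := Q - c ∘L F'
  have hR : ∀ y, L (R y) - y ∈ V := fun y ↦ by
    have h1 := V.neg_mem (hc (F' y))
    have h2 : ((F' y : F.range) : Y) = L (Q y) - y := rfl
    have h3 : L (R y) = L (Q y) - L (c (F' y)) := by simp [R]
    rw [h2] at h1
    rw [h3]
    convert h1 using 1
    abel
  refine ⟨R ∘L (1 - V.subtypeL ∘L p), fun y ↦ ?_, fun v hv ↦ ?_⟩
  · have h1 := V.sub_mem (hR (y - p y)) (p y).2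
    convert h1 using 1
    simp
    abel
  · have := hp ⟨v, hv⟩
    simp [this]

end RightInverses

/-! ### Index bundles of families transversal to a fixed subspace -/

section Families

variable {X Y : Type} [NormedAddCommGroup X] [NormedSpace ℝ X] [CompleteSpace X]
  [NormedAddCommGroup Y] [NormedSpace ℝ Y] [CompleteSpace Y]
  {B : Type} [TopologicalSpace B]

-- The right inverses modulo V form a convex set, and one of them extends continuously to nearby
-- parameters by `IsRightInverseMod.perturb`; a partition of unity glues the local choices.
omit [CompleteSpace X] in
theorem exists_continuous_isRightInverseMod [CompactSpace B] [T2Space B] {L : B → X →L[ℝ] Y}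
    (hL : Continuous L) (hF : ∀ b, (L b).IsFredholm) (V : Submodule ℝ Y) [FiniteDimensional ℝ V]
    (hV : ∀ b, (L b).range ⊔ V = ⊤) :
    ∃ R : B → Y →L[ℝ] X, Continuous R ∧ ∀ b, IsRightInverseMod (L b) V (R b) := by
  have hconv : ∀ b, Convex ℝ {R : Y →L[ℝ] X | IsRightInverseMod (L b) V R} := by
    intro b R hR R' hR' s t hs ht hst
    refine ⟨fun y ↦ ?_, fun v hv ↦ ?_⟩
    · have := V.add_mem (V.smul_mem s (hR.sub_mem y)) (V.smul_mem t (hR'.sub_mem y))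
      have h1 : y = s • y + t • y := by rw [← add_smul, hst, one_smul]
      have h2 : L b ((s • R + t • R') y) - y =
          s • (L b (R y) - y) + t • (L b (R' y) - y) := by
        have h3 : L b ((s • R + t • R') y) = s • L b (R y) + t • L b (R' y) := by simp
        rw [h3, smul_sub, smul_sub, sub_add_sub_comm, ← h1]
      rwa [h2]
    · simp [hR.apply_eq_zero v hv, hR'.apply_eq_zero v hv]
  obtain ⟨R, hR⟩ := exists_continuous_forall_mem_convex_of_local hconv fun b ↦ by
    obtain ⟨R₀, h₀⟩ := (hF b).exists_isRightInverseMod V (hV b)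
    have hM : Continuous fun b' ↦ (1 : Y →L[ℝ] Y) + (L b' - L b) ∘L R₀ :=
      continuous_const.add ((hL.sub continuous_const).clm_comp continuous_const)
    refine ⟨{b' | IsUnit ((1 : Y →L[ℝ] Y) + (L b' - L b) ∘L R₀)}, ?_,
      fun b' ↦ R₀ ∘L Ring.inverse (1 + (L b' - L b) ∘L R₀), ?_, fun b' hb' ↦ h₀.perturb hb'⟩
    · exact (Units.isOpen.preimage hM).mem_nhds (by simp)
    · intro b' hb'
      refine (continuousWithinAt_const.clm_comp (ContinuousAt.continuousWithinAt ?_))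
      exact ContinuousAt.comp (f := fun b' ↦ (1 : Y →L[ℝ] Y) + (L b' - L b) ∘L R₀)
        (g := Ring.inverse) (NormedRing.inverse_continuousAt hb'.unit) hM.continuousAt
  exact ⟨R, R.continuous, hR⟩

omit [CompleteSpace Y] in
theorem isBundleFamily_comap [ConnectedSpace B] {L : B → X →L[ℝ] Y} {R : B → Y →L[ℝ] X}
    {V : Submodule ℝ Y} (hL : Continuous L) (hR : Continuous R)
    (h : ∀ b, IsRightInverseMod (L b) V (R b))
    (hfin : ∀ b, FiniteDimensional ℝ (V.comap (L b : X →ₗ[ℝ] Y))) :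
    IsBundleFamily fun b ↦ V.comap (L b : X →ₗ[ℝ] Y) := by
  refine IsProjectionFamily.isBundleFamily (P := fun b ↦ 1 - R b ∘L L b)
    ⟨continuous_const.sub (hR.clm_comp hL), fun b x ↦ (h b).comp_sub_mem x, fun b x hx ↦ ?_⟩ hfin
  simp [(h b).comp_eq_zero hx]

omit [CompleteSpace X] [CompleteSpace Y] in
/-- The difference `[L⁻¹(V)] - [Θ(V)]` does not depend on the transversal subspace `V`. -/
theorem familyIso_comap_prod {L : B → X →L[ℝ] Y} {R R' : B → Y →L[ℝ] X} {V V' : Submodule ℝ Y}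
    (hL : Continuous L) (hR : Continuous R) (hR' : Continuous R')
    (h : ∀ b, IsRightInverseMod (L b) V (R b)) (h' : ∀ b, IsRightInverseMod (L b) V' (R' b)) :
    FamilyIso (fun b ↦ (V.comap (L b : X →ₗ[ℝ] Y)).prod V')
      (fun b ↦ (V'.comap (L b : X →ₗ[ℝ] Y)).prod V) := by
  -- Both sums are isomorphic to the space of (x, w) with w ∈ V' and Lx + w ∈ V: on the left through
  -- x = e - Rw. The substitution w ↦ -(Lx + w) is an involution that exchanges the roles of V and
  -- V', and x + R'w' recovers the first component on the right.
  have key : ∀ {R R' : B → Y →L[ℝ] X} {V V' : Submodule ℝ Y}, Continuous R → Continuous R' →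
      (∀ b, IsRightInverseMod (L b) V (R b)) → (∀ b, IsRightInverseMod (L b) V' (R' b)) →
      ∃ T : B → X × Y →L[ℝ] X × Y, Continuous T ∧
        (∀ b e w, T b (e, w) = (e - R b w - R' b (L b (e - R b w) + w),
          -(L b (e - R b w) + w))) ∧
        ∀ b, ∀ p ∈ (V.comap (L b : X →ₗ[ℝ] Y)).prod V',
          T b p ∈ (V'.comap (L b : X →ₗ[ℝ] Y)).prod V := by
    intro R R' V V' hR hR' h h'
    let x : B → X × Y →L[ℝ] X := fun b ↦
      ContinuousLinearMap.fst ℝ X Y - R b ∘L ContinuousLinearMap.snd ℝ X Y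
    have hx : Continuous x := continuous_const.sub (hR.clm_comp continuous_const)
    let v : B → X × Y →L[ℝ] Y := fun b ↦ L b ∘L x b + ContinuousLinearMap.snd ℝ X Y
    have hv : Continuous v := (hL.clm_comp hx).add continuous_const
    refine ⟨fun b ↦ ContinuousLinearMap.inl ℝ X Y ∘L (x b - R' b ∘L v b) -
      ContinuousLinearMap.inr ℝ X Y ∘L v b, ?_, fun b e w ↦ ?_, fun b p hp ↦ ?_⟩
    · exact (continuous_const.clm_comp (hx.sub (hR'.clm_comp hv))).sub
        (continuous_const.clm_comp hv)
    · simp [x, v]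
    · obtain ⟨e, w⟩ := p
      obtain ⟨he, hw⟩ := hp
      have h1 : L b (e - R b w) + w ∈ V := by
        have h2 : L b (e - R b w) + w = L b e - (L b (R b w) - w) := by rw [map_sub]; abel
        rw [h2]
        exact V.sub_mem he ((h b).sub_mem w)
      have h3 : -w - (L b (R' b (L b (e - R b w) + w)) - (L b (e - R b w) + w)) ∈ V' :=
        V'.sub_mem (V'.neg_mem hw) ((h' b).sub_mem _)
      refine ⟨?_, by simpa [x, v] using V.neg_mem h1⟩
      have h4 : L b (e - R b w - R' b (L b (e - R b w) + w)) =
          -w - (L b (R' b (L b (e - R b w) + w)) - (L b (e - R b w) + w)) := by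
        rw [map_sub (L b) (e - R b w)]
        abel
      rw [← h4] at h3
      simpa [x, v] using h3
  obtain ⟨T, hT, hTf, hTm⟩ := key hR hR' h h'
  obtain ⟨S, hS, hSf, hSm⟩ := key hR' hR h' h
  have hinv : ∀ (x : X) (w : Y) (l : X →L[ℝ] Y) (r r' : Y →L[ℝ] X),
      (x - r' (l x + w) - r' (-(l x + w)) -
        r (l (x - r' (l x + w) - r' (-(l x + w))) + -(l x + w)),
      -(l (x - r' (l x + w) - r' (-(l x + w))) + -(l x + w))) = (x + r w, w) := by
    intro x w l r r'
    have h1 : x - r' (l x + w) - r' (-(l x + w)) = x := by rw [map_neg]; abel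
    have h2 : l x + -(l x + w) = -w := by abel
    rw [h1, h2, map_neg, neg_neg, sub_neg_eq_add]
  refine ⟨T, S, hT, hS, fun b ↦ ⟨fun p hp ↦ ⟨hTm b p hp, ?_⟩, fun p hp ↦ ⟨hSm b p hp, ?_⟩⟩⟩
  · obtain ⟨e, w⟩ := p
    rw [hTf, hSf, hinv (e - R b w), sub_add_cancel]
  · obtain ⟨e, w⟩ := p
    rw [hSf, hTf, hinv (e - R' b w), sub_add_cancel]

/-- Knowledge of one transversal subspace suffices: `familyIso_comap_prod` transfers the difference
of classes to any other. -/
theorem IsIndexBundle.of_hasClass [CompactSpace B] [T2Space B] [ConnectedSpace B]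
    {L : B → X →L[ℝ] Y} (hL : Continuous L) (hF : ∀ b, (L b).IsFredholm)
    {V : Submodule ℝ Y} [FiniteDimensional ℝ V] (hV : ∀ b, (L b).range ⊔ V = ⊤) {x : Vect B}
    (hx : HasClass (fun b ↦ V.comap (L b : X →ₗ[ℝ] Y)) x) :
    IsIndexBundle L (KO.of x - KO.of (Vect.mk (RealVectorBundle.trivial B V))) where
  continuous := hL
  isFredholm := hF
  exists_transversal := ⟨V, inferInstance, hV⟩
  eq_of_transversal V' _ hV' := by
    obtain ⟨R, hR, h⟩ := exists_continuous_isRightInverseMod hL hF V hV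
    obtain ⟨R', hR', h'⟩ := exists_continuous_isRightInverseMod hL hF V' hV'
    have hE := isBundleFamily_comap hL hR' h' fun b ↦ (hF b).finiteDimensional_comap V'
    refine ⟨hE, ?_⟩
    have h1 := ((hx.prod (hasClass_const V')).congr
      (familyIso_comap_prod hL hR hR' h h')).unique (hE.hasClass.prod (hasClass_const V))
    have h2 := congrArg KO.of h1
    rw [KO.of_add, KO.of_add] at h2
    rw [sub_eq_sub_iff_add_eq_add, h2]

-- Rank count in the exact sequence 0 → Ker L → L⁻¹(V) → V → Coker L → 0, whose last map is onto by
-- transversality.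
omit [CompleteSpace X] [CompleteSpace Y] in
theorem ContinuousLinearMap.finrank_comap_sub_finrank {L : X →L[ℝ] Y} (hL : L.IsFredholm)
    (V : Submodule ℝ Y) [FiniteDimensional ℝ V] (hV : L.range ⊔ V = ⊤) :
    (Module.finrank ℝ (V.comap (L : X →ₗ[ℝ] Y)) : ℤ) - Module.finrank ℝ V = fredholmIndex L := by
  have := hL.finiteDimensional_comap V
  let g : V.comap (L : X →ₗ[ℝ] Y) →ₗ[ℝ] V := (L : X →ₗ[ℝ] Y).restrict fun x hx ↦ hx
  let f : V →ₗ[ℝ] Y ⧸ L.range := L.range.mkQ ∘ₗ V.subtype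
  have hf : LinearMap.range f = ⊤ := by
    rw [LinearMap.range_comp, Submodule.range_subtype, Submodule.map_mkQ_eq_top, sup_comm]
    rw [← hV, sup_comm]
  have hfg : LinearMap.ker f = LinearMap.range g := by
    ext v
    simp only [f, LinearMap.mem_ker, LinearMap.comp_apply, Submodule.mkQ_apply,
      Submodule.Quotient.mk_eq_zero, LinearMap.mem_range]
    constructor
    · rintro ⟨x, hx⟩
      exact ⟨⟨x, by simp [hx]⟩, Subtype.ext hx⟩
    · rintro ⟨x, rfl⟩
      exact ⟨x, rfl⟩
  let k : LinearMap.ker g ≃ₗ[ℝ] L.ker :=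
    { toFun := fun x ↦ ⟨x.1.1, congrArg Subtype.val x.2⟩
      invFun := fun x ↦ ⟨⟨x, by
        simp⟩, Subtype.ext x.2⟩
      map_add' := fun _ _ ↦ rfl
      map_smul' := fun _ _ ↦ rfl
      left_inv := fun _ ↦ rfl
      right_inv := fun _ ↦ rfl }
  have h1 := f.finrank_range_add_finrank_ker
  have h2 := g.finrank_range_add_finrank_ker
  rw [hf, finrank_top, hfg] at h1
  rw [k.finrank_eq] at h2
  unfold fredholmIndex
  omega

omit [CompleteSpace X] [CompleteSpace Y] in
theorem IsIndexBundle.rank_eq [CompactSpace B] [T2Space B] [ConnectedSpace B]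
    {L : B → X →L[ℝ] Y} {η : KO B} (h : IsIndexBundle L η) (b : B) :
    KO.rank η = fredholmIndex (L b) := by
  obtain ⟨V, hfin, hV⟩ := h.exists_transversal
  obtain ⟨hE, rfl⟩ := h.eq_of_transversal V hV
  rw [map_sub, KO.rank_of, KO.rank_of, hE.hasClass.rank_eq b, (hasClass_const V).rank_eq b,
    ContinuousLinearMap.finrank_comap_sub_finrank (h.isFredholm b) V (hV b)]

end Families

/-! ### Operators on spaces of sequences that vanish at infinity -/

section SequenceOperators

variable {𝕜 E F G : Type*} [RCLike 𝕜] [NormedAddCommGroup E] [NormedSpace 𝕜 E]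
  [NormedAddCommGroup F] [NormedSpace 𝕜 F] [NormedAddCommGroup G] [NormedSpace 𝕜 G]

namespace ZeroSeq

omit [NormedSpace 𝕜 E] in
theorem norm_apply_le (x : C₀(ℤ, E)) (n : ℤ) : ‖x n‖ ≤ ‖x‖ := x.toBCF.norm_coe_le_norm n

omit [NormedSpace 𝕜 E] in
theorem norm_le {x : C₀(ℤ, E)} {C : ℝ} (hC : 0 ≤ C) (h : ∀ n, ‖x n‖ ≤ C) : ‖x‖ ≤ C :=
  (BoundedContinuousFunction.norm_le (f := x.toBCF) hC).2 h

variable (𝕜) in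
/-- The shift `x ↦ (x_{n+k})_n`. -/
def shift (k : ℤ) : C₀(ℤ, E) →L[𝕜] C₀(ℤ, E) :=
  LinearMap.mkContinuous
    { toFun := fun x ↦
        { toFun := fun n ↦ x (n + k)
          continuous_toFun := continuous_of_discreteTopology
          zero_at_infty' := x.zero_at_infty'.comp
            (Homeomorph.addRight k).isClosedEmbedding.tendsto_cocompact }
      map_add' := fun _ _ ↦ rfl
      map_smul' := fun _ _ ↦ rfl }
    1 fun x ↦ by
      rw [one_mul]
      exact norm_le (norm_nonneg x) fun n ↦ norm_apply_le x (n + k)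

@[simp]
theorem shift_apply (k : ℤ) (x : C₀(ℤ, E)) (n : ℤ) : shift 𝕜 k x n = x (n + k) := rfl

theorem norm_shift_le (k : ℤ) : ‖(shift 𝕜 k : C₀(ℤ, E) →L[𝕜] C₀(ℤ, E))‖ ≤ 1 :=
  LinearMap.mkContinuous_norm_le _ zero_le_one _

/-- The operator that applies `f` to each term of a sequence. -/
def map (f : E →L[𝕜] F) : C₀(ℤ, E) →L[𝕜] C₀(ℤ, F) :=
  LinearMap.mkContinuous
    { toFun := fun x ↦
        { toFun := fun n ↦ f (x n)
          continuous_toFun := continuous_of_discreteTopology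
          zero_at_infty' := by
            have h := (f.continuous.tendsto 0).comp x.zero_at_infty'
            rwa [map_zero] at h }
      map_add' := fun _ _ ↦ by ext; simp
      map_smul' := fun _ _ ↦ by ext; simp }
    ‖f‖ fun x ↦ norm_le (by positivity) fun n ↦
      (f.le_opNorm _).trans (mul_le_mul_of_nonneg_left (norm_apply_le x n) (norm_nonneg f))

@[simp]
theorem map_apply (f : E →L[𝕜] F) (x : C₀(ℤ, E)) (n : ℤ) : map f x n = f (x n) := rfl

theorem norm_map_le (f : E →L[𝕜] F) : ‖map f‖ ≤ ‖f‖ :=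
  LinearMap.mkContinuous_norm_le _ (norm_nonneg f) _

theorem continuous_map : Continuous (map : (E →L[𝕜] F) → C₀(ℤ, E) →L[𝕜] C₀(ℤ, F)) := by
  let m : (E →L[𝕜] F) →ₗ[𝕜] C₀(ℤ, E) →L[𝕜] C₀(ℤ, F) :=
    { toFun := map
      map_add' := fun _ _ ↦ rfl
      map_smul' := fun _ _ ↦ rfl }
  exact AddMonoidHomClass.continuous_of_bound m 1 fun f ↦ by
    rw [one_mul]
    exact norm_map_le f

variable (𝕜 E) in
/-- `map` as a homomorphism of algebras. -/
def mapAlgHom : (E →L[𝕜] E) →ₐ[𝕜] C₀(ℤ, E) →L[𝕜] C₀(ℤ, E) where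
  toFun := map
  map_one' := rfl
  map_mul' _ _ := rfl
  map_zero' := rfl
  map_add' _ _ := rfl
  commutes' _ := rfl

variable (𝕜) in
open Classical in
/-- The restriction of sequences to `s`, extended by zero. -/
def cutoff (s : Set ℤ) : C₀(ℤ, E) →L[𝕜] C₀(ℤ, E) :=
  LinearMap.mkContinuous
    { toFun := fun x ↦
        { toFun := fun n ↦ if n ∈ s then x n else 0
          continuous_toFun := continuous_of_discreteTopology
          zero_at_infty' := by
            refine squeeze_zero_norm (fun n ↦ ?_) (by simpa using x.zero_at_infty'.norm)
            split_ifs <;> simp }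
      map_add' := fun _ _ ↦ by ext; simp; split_ifs <;> simp
      map_smul' := fun _ _ ↦ by ext; simp }
    1 fun x ↦ by
      rw [one_mul]
      refine norm_le (norm_nonneg x) fun n ↦ ?_
      simp only [LinearMap.coe_mk, AddHom.coe_mk, ZeroAtInftyContinuousMap.coe_mk]
      split_ifs
      · exact norm_apply_le x n
      · simp

open Classical in
theorem cutoff_apply (s : Set ℤ) (x : C₀(ℤ, E)) (n : ℤ) :
    cutoff 𝕜 s x n = if n ∈ s then x n else 0 := rfl

theorem cutoff_apply_of_mem {s : Set ℤ} (x : C₀(ℤ, E)) {n : ℤ} (h : n ∈ s) :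
    cutoff 𝕜 s x n = x n := if_pos h

theorem cutoff_apply_of_notMem {s : Set ℤ} (x : C₀(ℤ, E)) {n : ℤ} (h : n ∉ s) :
    cutoff 𝕜 s x n = 0 := if_neg h

variable (𝕜) in
/-- The evaluation of sequences at `k`. -/
def eval (k : ℤ) : C₀(ℤ, E) →L[𝕜] E :=
  LinearMap.mkContinuous
    { toFun := fun x ↦ x k
      map_add' := fun _ _ ↦ rfl
      map_smul' := fun _ _ ↦ rfl }
    1 fun x ↦ by
      rw [one_mul]
      exact norm_apply_le x k

@[simp]
theorem eval_apply (k : ℤ) (x : C₀(ℤ, E)) : eval 𝕜 k x = x k := rfl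

variable (𝕜) in
/-- The sequence with the single term `v` at the place `k`. -/
def single (k : ℤ) : E →L[𝕜] C₀(ℤ, E) :=
  LinearMap.mkContinuous
    { toFun := fun v ↦
        { toFun := fun n ↦ if n = k then v else 0
          continuous_toFun := continuous_of_discreteTopology
          zero_at_infty' := by
            rw [cocompact_eq_cofinite]
            refine tendsto_const_nhds.congr' ?_
            filter_upwards [(Set.finite_singleton k).compl_mem_cofinite] with n hn
            rw [if_neg (by simpa using hn)] }
      map_add' := fun _ _ ↦ by ext; simp; split_ifs <;> simp
      map_smul' := fun _ _ ↦ by ext; simp }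
    1 fun v ↦ by
      rw [one_mul]
      refine norm_le (norm_nonneg v) fun n ↦ ?_
      simp only [LinearMap.coe_mk, AddHom.coe_mk, ZeroAtInftyContinuousMap.coe_mk]
      split_ifs <;> simp

theorem single_apply (k : ℤ) (v : E) (n : ℤ) : single 𝕜 k v n = if n = k then v else 0 := rfl

@[simp]
theorem single_apply_self (k : ℤ) (v : E) : single 𝕜 k v k = v := if_pos rfl

theorem single_apply_of_ne {k n : ℤ} (h : n ≠ k) (v : E) : single 𝕜 k v n = 0 := if_neg h

/-- A null sequence indexed by `ℕ` extends by zero to a sequence that vanishes at infinity. -/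
theorem exists_of_tendsto {u : ℕ → E} (hu : Tendsto u atTop (𝓝 0)) :
    ∃ x : C₀(ℤ, E), (∀ n : ℕ, x n = u n) ∧ ∀ n : ℤ, n < 0 → x n = 0 := by
  refine ⟨⟨⟨fun n : ℤ ↦ if 0 ≤ n then u n.toNat else 0, continuous_of_discreteTopology⟩, ?_⟩,
    fun n ↦ ?_, fun n hn ↦ if_neg (not_le.2 hn)⟩
  · rw [cocompact_eq_cofinite, Int.cofinite_eq]
    refine tendsto_sup.2 ⟨?_, ?_⟩
    · refine tendsto_const_nhds.congr' ?_
      filter_upwards [eventually_lt_atBot 0] with n hn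
      exact (if_neg (not_le.2 hn)).symm
    · refine (hu.comp (tendsto_atTop.2 fun b ↦ by
        filter_upwards [eventually_ge_atTop (b : ℤ)] with n hn
        omega : Tendsto Int.toNat atTop atTop)).congr' ?_
      filter_upwards [eventually_ge_atTop 0] with n hn
      exact (if_pos hn).symm
  · change (if (0 : ℤ) ≤ n then u (n : ℤ).toNat else 0) = u n
    simp

theorem tendsto_natCast (x : C₀(ℤ, E)) : Tendsto (fun n : ℕ ↦ x n) atTop (𝓝 0) := by
  have h := x.zero_at_infty'
  rw [cocompact_eq_cofinite, Int.cofinite_eq] at h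
  exact (h.mono_left le_sup_right).comp tendsto_natCast_atTop_atTop

end ZeroSeq

end SequenceOperators

/-! ### Invertibility of `S - A` for hyperbolic `A` -/

section Invertibility

theorem Commute.exists_aeval_sub_aeval {R A : Type*} [CommRing R] [Ring A] [Algebra R A] {x y : A}
    (h : Commute x y) (p : Polynomial R) :
    ∃ q : A, Polynomial.aeval x p - Polynomial.aeval y p = (x - y) * q ∧
      Polynomial.aeval x p - Polynomial.aeval y p = q * (x - y) := by
  induction p using Polynomial.induction_on' with
  | add p q hp hq =>
    obtain ⟨r, h1, h2⟩ := hp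
    obtain ⟨s, h3, h4⟩ := hq
    refine ⟨r + s, ?_, ?_⟩
    · rw [map_add, map_add, mul_add, ← h1, ← h3]; abel
    · rw [map_add, map_add, add_mul, ← h2, ← h4]; abel
  | monomial n c =>
    refine ⟨c • ∑ i ∈ Finset.range n, x ^ i * y ^ (n - 1 - i), ?_, ?_⟩
    · rw [mul_smul_comm, h.mul_geom_sum₂, smul_sub]
      simp [Polynomial.aeval_monomial, Algebra.smul_def]
    · rw [smul_mul_assoc, h.geom_sum₂_mul, smul_sub]
      simp [Polynomial.aeval_monomial, Algebra.smul_def]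

theorem isUnit_of_mul_eq_of_mul_eq {A : Type*} [Ring A] {a b c u : A} (hu : IsUnit u)
    (h1 : a * b = u) (h2 : c * a = u) : IsUnit a := by
  obtain ⟨u, rfl⟩ := hu
  refine isUnit_iff_exists_and_exists.2 ⟨⟨b * ↑u⁻¹, ?_⟩, ⟨↑u⁻¹ * c, ?_⟩⟩
  · rw [← mul_assoc, h1, u.mul_inv]
  · rw [mul_assoc, h2, u.inv_mul]

/-- For commuting x and y, x - y divides p(x) - p(y) = p(x) from both sides, and p(x) is invertible.
-/
theorem isUnit_sub_of_isUnit_aeval {R A : Type*} [CommRing R] [Ring A] [Algebra R A] {x y : A}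
    (h : Commute x y) {p : Polynomial R} (hx : IsUnit (Polynomial.aeval x p))
    (hy : Polynomial.aeval y p = 0) : IsUnit (x - y) := by
  obtain ⟨q, h1, h2⟩ := h.exists_aeval_sub_aeval p
  rw [hy, sub_zero] at h1 h2
  exact isUnit_of_mul_eq_of_mul_eq hx h1.symm h2.symm

/-- S and its inverse T are contractions, so a Neumann series inverts 1 - zT for |z| < 1 and 1 -
z⁻¹S for |z| > 1; up to an invertible factor these are z - S. -/
theorem notMem_spectrum_of_norm_le_one {Z : Type*} [NormedAddCommGroup Z] [NormedSpace ℂ Z]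
    [CompleteSpace Z] {S T : Z →L[ℂ] Z} (hST : S * T = 1) (hTS : T * S = 1) (hS : ‖S‖ ≤ 1)
    (hT : ‖T‖ ≤ 1) {z : ℂ} (hz : ‖z‖ ≠ 1) : z ∉ spectrum ℂ S := by
  rw [spectrum.notMem_iff]
  rcases lt_or_gt_of_ne hz with h | h
  · have h1 : ‖z • T‖ < 1 := by
      rw [norm_smul]
      exact (mul_le_of_le_one_right (norm_nonneg z) hT).trans_lt h
    have h2 : IsUnit S := isUnit_of_mul_eq_of_mul_eq isUnit_one hST hTS
    have h3 := (h2.mul (isUnit_one_sub_of_norm_lt_one h1)).neg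
    convert h3 using 1
    rw [mul_sub, mul_one, mul_smul_comm, hST, Algebra.algebraMap_eq_smul_one]
    abel
  · have hz0 : z ≠ 0 := by
      rintro rfl
      simp at h
      linarith
    have h1 : ‖z⁻¹ • S‖ < 1 := by
      rw [norm_smul, norm_inv]
      refine (mul_le_of_le_one_right (by positivity) hS).trans_lt ?_
      exact inv_lt_one_of_one_lt₀ h
    have h2 := (IsUnit.mk0 z hz0).map (algebraMap ℂ (Z →L[ℂ] Z))
    have h3 := h2.mul (isUnit_one_sub_of_norm_lt_one h1)
    convert h3 using 1
    rw [mul_sub, mul_one, Algebra.algebraMap_eq_smul_one, smul_mul_assoc, one_mul, smul_smul,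
      mul_inv_cancel₀ hz0, one_smul]

theorem ZeroSeq.notMem_spectrum_shift {E : Type*} [NormedAddCommGroup E] [NormedSpace ℂ E]
    [CompleteSpace E] {z : ℂ} (hz : ‖z‖ ≠ 1) :
    z ∉ spectrum ℂ (ZeroSeq.shift ℂ 1 : C₀(ℤ, E) →L[ℂ] C₀(ℤ, E)) := by
  have hST : (ZeroSeq.shift ℂ 1 : C₀(ℤ, E) →L[ℂ] C₀(ℤ, E)) * ZeroSeq.shift ℂ (-1) = 1 := by
    ext x n; simp
  have hTS : (ZeroSeq.shift ℂ (-1) : C₀(ℤ, E) →L[ℂ] C₀(ℤ, E)) * ZeroSeq.shift ℂ 1 = 1 := by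
    ext x n; simp
  exact notMem_spectrum_of_norm_le_one hST hTS (ZeroSeq.norm_shift_le _) (ZeroSeq.norm_shift_le _) hz

/-- Take the characteristic polynomial p of M. It annihilates M by Cayley–Hamilton, while p(S) is a
product of factors S - z over eigenvalues z of M, none on the unit circle, hence invertible. -/
theorem isUnit_shift_sub_map_complex {N : ℕ} {M : Matrix (Fin N) (Fin N) ℂ}
    (hM : ∀ z ∈ spectrum ℂ M, ‖z‖ ≠ 1) :
    IsUnit (ZeroSeq.shift ℂ 1 - ZeroSeq.map (Matrix.toEuclideanCLM (n := Fin N) (𝕜 := ℂ) M)) := by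
  refine isUnit_sub_of_isUnit_aeval (p := M.charpoly) ?_ ?_ ?_
  · ext x n; rfl
  · by_contra h
    have h1 := IsAlgClosed.splits M.charpoly
    rw [h1.eq_prod_roots, M.charpoly_monic.leadingCoeff, map_one, one_mul] at h
    obtain ⟨z, hz, hz'⟩ := spectrum.exists_mem_of_not_isUnit_aeval_prod h
    refine ZeroSeq.notMem_spectrum_shift (hM z ?_) hz
    rw [Matrix.mem_spectrum_iff_isRoot_charpoly]
    exact hz'
  · have h1 : ZeroSeq.map (Matrix.toEuclideanCLM (n := Fin N) (𝕜 := ℂ) M) =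
        (ZeroSeq.mapAlgHom ℂ (EuclideanSpace ℂ (Fin N))).comp
          (Matrix.toEuclideanCLM (n := Fin N) (𝕜 := ℂ)).toAlgEquiv.toAlgHom M := rfl
    rw [h1, Polynomial.aeval_algHom_apply, Matrix.aeval_self_charpoly, map_zero]

/-- The operator `S - A` of a hyperbolic matrix is invertible. -/
theorem isUnit_shift_sub_map {N : ℕ} {M : Matrix (Fin N) (Fin N) ℝ} (hM : IsHyperbolic M) :
    IsUnit (ZeroSeq.shift ℝ 1 - ZeroSeq.map (Matrix.toEuclideanCLM (n := Fin N) (𝕜 := ℝ) M)) := by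
  have hC := isUnit_shift_sub_map_complex hM
  rw [ContinuousLinearMap.isUnit_iff_bijective] at hC ⊢
  -- The inclusion `ι` and the real part `ρ` both intertwine the real and the complex operator, and
  -- `ρ` retracts `ι`. Injectivity and surjectivity therefore descend from the complex case.
  let ι : EuclideanSpace ℝ (Fin N) →L[ℝ] EuclideanSpace ℂ (Fin N) := LinearMap.toContinuousLinearMap
    { toFun := fun x ↦ WithLp.toLp 2 fun i ↦ (x i : ℂ)
      map_add' := fun x y ↦ by ext i; simp
      map_smul' := fun c x ↦ by ext i; simp }
  let ρ : EuclideanSpace ℂ (Fin N) →L[ℝ] EuclideanSpace ℝ (Fin N) := LinearMap.toContinuousLinearMap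
    { toFun := fun x ↦ WithLp.toLp 2 fun i ↦ (x i).re
      map_add' := fun x y ↦ by ext i; simp
      map_smul' := fun c x ↦ by ext i; simp }
  have hρι : ∀ x, ρ (ι x) = x := fun x ↦ by ext i; simp [ρ, ι]
  have hιM : ∀ x, ι (Matrix.toEuclideanCLM (n := Fin N) (𝕜 := ℝ) M x) =
      Matrix.toEuclideanCLM (n := Fin N) (𝕜 := ℂ) (M.map fun t : ℝ ↦ (t : ℂ)) (ι x) := fun x ↦ by
    ext i
    simp [ι, Matrix.mulVec, dotProduct]
  have hρM : ∀ x, ρ (Matrix.toEuclideanCLM (n := Fin N) (𝕜 := ℂ) (M.map fun t : ℝ ↦ (t : ℂ)) x) =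
      Matrix.toEuclideanCLM (n := Fin N) (𝕜 := ℝ) M (ρ x) := fun x ↦ by
    ext i
    simp [ρ, Matrix.mulVec, dotProduct]
  refine ⟨(injective_iff_map_eq_zero _).2 fun x hx ↦ ?_, fun y ↦ ?_⟩
  · have h1 := (injective_iff_map_eq_zero _).1 hC.1 (ZeroSeq.map ι x) (by
      ext1 n
      have := congrArg ι (DFunLike.congr_fun hx n)
      simpa [hιM] using this)
    ext1 n
    have h2 := congrArg ρ (DFunLike.congr_fun h1 n)
    simpa [hρι] using h2
  · obtain ⟨x, hx⟩ := hC.2 (ZeroSeq.map ι y)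
    refine ⟨ZeroSeq.map ρ x, ?_⟩
    ext1 n
    have h2 := congrArg ρ (DFunLike.congr_fun hx n)
    simpa [hρι, hρM] using h2

end Invertibility

/-! ### The dynamical characterization of the stable subspace -/

section StableSubspace

theorem tendsto_zero_of_recurrence {E : Type*} [NormedAddCommGroup E] [NormedSpace ℂ E] {z : ℂ}
    (hz : ‖z‖ < 1) {u e : ℕ → E} (hu : ∀ n, u (n + 1) = z • u n + e n)
    (he : Tendsto e atTop (𝓝 0)) : Tendsto u atTop (𝓝 0) := by
  rw [Metric.tendsto_atTop]
  intro ε hε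
  have hr : 0 < 1 - ‖z‖ := by linarith
  -- With this bound on the error, ε / 2 is the fixed point of t ↦ ‖z‖ t + (1 - ‖z‖) ε / 2, so the
  -- excess over ε / 2 decays geometrically.
  obtain ⟨n₀, hn₀⟩ := Metric.tendsto_atTop.1 he ((1 - ‖z‖) * (ε / 2)) (by positivity)
  have h1 : ∀ k, ‖u (n₀ + k)‖ - ε / 2 ≤ ‖z‖ ^ k * |‖u n₀‖ - ε / 2| := by
    intro k
    induction k with
    | zero => simpa using le_abs_self (‖u n₀‖ - ε / 2)
    | succ k ih =>
      have h2 := hn₀ (n₀ + k) (by omega)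
      rw [dist_zero_right] at h2
      have h3 : ‖u (n₀ + (k + 1))‖ ≤ ‖z‖ * ‖u (n₀ + k)‖ + ‖e (n₀ + k)‖ := by
        rw [← add_assoc, hu, ← norm_smul]
        exact norm_add_le _ _
      have h4 := mul_le_mul_of_nonneg_left ih (norm_nonneg z)
      rw [pow_succ']
      nlinarith
  have h5 : Tendsto (fun k ↦ ‖z‖ ^ k * |‖u n₀‖ - ε / 2|) atTop (𝓝 0) := by
    simpa using (tendsto_pow_atTop_nhds_zero_of_lt_one (norm_nonneg z) hz).mul_const _
  obtain ⟨k₀, hk₀⟩ := Metric.tendsto_atTop.1 h5 (ε / 2) (by positivity)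
  refine ⟨n₀ + k₀, fun n hn ↦ ?_⟩
  obtain ⟨k, rfl⟩ := Nat.exists_eq_add_of_le (le_trans (Nat.le_add_right n₀ k₀) hn)
  have h6 := hk₀ k (by omega)
  rw [Real.dist_0_eq_abs] at h6
  have h7 := (le_abs_self _).trans_lt h6
  have h8 := h1 k
  rw [dist_zero_right]
  linarith

variable {V : Type*} [NormedAddCommGroup V] [NormedSpace ℂ V]

/-- The vectors whose forward orbit under `f` tends to zero. -/
def decaySubspace (f : Module.End ℂ V) : Submodule ℂ V where
  carrier := {v | Tendsto (fun n ↦ (f ^ n) v) atTop (𝓝 0)}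
  add_mem' h h' := by simpa using h.add h'
  zero_mem' := by simp
  smul_mem' c v h := by simpa using h.const_smul c

theorem mem_decaySubspace {f : Module.End ℂ V} {v : V} :
    v ∈ decaySubspace f ↔ Tendsto (fun n ↦ (f ^ n) v) atTop (𝓝 0) := Iff.rfl

/-- Induction on the order of the generalized eigenvector: the orbit of v satisfies uₙ₊₁ = z uₙ +
eₙ, where e is the orbit of (f - z)v and decays by induction. -/
theorem maxGenEigenspace_le_decaySubspace (f : Module.End ℂ V) {z : ℂ} (hz : ‖z‖ < 1) :
    f.maxGenEigenspace z ≤ decaySubspace f := by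
  intro v hv
  obtain ⟨k, hk⟩ := Module.End.mem_maxGenEigenspace _ _ _ |>.1 hv
  clear hv
  induction k generalizing v with
  | zero =>
    have : v = 0 := by simpa using hk
    simp [this]
  | succ k ih =>
    have h1 := ih (v := (f - z • 1) v) (by rw [← Module.End.mul_apply, ← pow_succ]; exact hk)
    refine tendsto_zero_of_recurrence hz (e := fun n ↦ (f ^ n) ((f - z • 1) v)) (fun n ↦ ?_) h1
    simp [pow_succ]

/-- The decay subspace is invariant, hence the sum of its intersections with the generalized
eigenspaces. For |z| ≥ 1 a nonzero intersection would contain an eigenvector, whose orbit does not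
shrink. -/
theorem decaySubspace_eq [FiniteDimensional ℂ V] {f : Module.End ℂ V}
    (hf : ∀ z, f.HasEigenvalue z → ‖z‖ ≠ 1) :
    decaySubspace f = ⨆ z : ℂ, ⨆ _ : ‖z‖ < 1, f.maxGenEigenspace z := by
  refine le_antisymm ?_ (iSup₂_le fun z hz ↦ maxGenEigenspace_le_decaySubspace f hz)
  have hinv : ∀ v ∈ decaySubspace f, f v ∈ decaySubspace f := fun v hv ↦ by
    refine (hv.comp (tendsto_add_atTop_nat 1)).congr fun n ↦ ?_
    simp [pow_succ]
  have h1 := Submodule.inf_iSup_genEigenspace hinv ⊤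
  have h2 : ⨆ z, f.genEigenspace z ⊤ = ⊤ := Module.End.iSup_maxGenEigenspace_eq_top f
  rw [h2, inf_top_eq] at h1
  rw [h1]
  refine iSup_le fun z ↦ ?_
  by_cases hz : ‖z‖ < 1
  · exact inf_le_right.trans (le_iSup₂_of_le z hz le_rfl)
  · have h3 : decaySubspace f ⊓ f.genEigenspace z ⊤ = ⊥ := by
      refine (Submodule.eq_bot_iff _).2 fun v ⟨hv, hv'⟩ ↦ ?_
      obtain ⟨k, hk⟩ := Module.End.mem_maxGenEigenspace _ _ _ |>.1 hv'
      clear hv'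
      have hpow : ∀ v ∈ decaySubspace f, ∀ k : ℕ, ((f - z • 1) ^ k) v ∈ decaySubspace f := by
        intro v hv k
        induction k with
        | zero => simpa using hv
        | succ k ih =>
          rw [pow_succ', Module.End.mul_apply]
          exact sub_mem (hinv _ ih) (Submodule.smul_mem _ z ih)
      induction k with
      | zero => simpa using hk
      | succ k ih =>
        refine ih ?_
        set w := ((f - z • 1) ^ k) v with hw
        by_contra hw0
        have hfw : f w = z • w := by
          rw [pow_succ', Module.End.mul_apply, ← hw] at hk
          simpa [sub_eq_zero] using hk
        have hwd : w ∈ decaySubspace f := hpow v hv k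
        have hz1 : ‖z‖ ≠ 1 := hf z (Module.End.hasEigenvalue_of_hasEigenvector
          ⟨Module.End.mem_eigenspace_iff.2 hfw, hw0⟩)
        have hfn : ∀ n, (f ^ n) w = z ^ n • w := fun n ↦ by
          induction n with
          | zero => simp
          | succ n ih => rw [pow_succ', Module.End.mul_apply, ih, map_smul, hfw, smul_smul, pow_succ]
        have h4 := (mem_decaySubspace.1 hwd).norm
        have h5 : ∀ n, ‖w‖ ≤ ‖(f ^ n) w‖ := fun n ↦ by
          rw [hfn, norm_smul, norm_pow]
          exact le_mul_of_one_le_left (norm_nonneg w) (one_le_pow₀ (not_lt.1 hz))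
        have h6 := ge_of_tendsto' h4 h5
        rw [norm_zero] at h6
        exact hw0 (norm_le_zero_iff.1 h6)
    rw [h3]
    exact bot_le

variable {N : ℕ}

/-- The stable subspace of a hyperbolic matrix consists of the vectors with decaying orbit. -/
theorem mem_stableSubspace_iff {M : Matrix (Fin N) (Fin N) ℝ} (hM : IsHyperbolic M)
    {v : EuclideanSpace ℝ (Fin N)} :
    v ∈ stableSubspace M ↔
      Tendsto (fun n ↦ (Matrix.toEuclideanCLM (n := Fin N) (𝕜 := ℝ) M ^ n) v) atTop (𝓝 0) := by
  set A := Matrix.toEuclideanCLM (n := Fin N) (𝕜 := ℝ) M with hA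
  set f : Module.End ℂ (Fin N → ℂ) := Matrix.toLin' (M.map (fun t : ℝ ↦ (t : ℂ))) with hf
  have h1 : ∀ n v, complexify N ((A ^ n) v) = (f ^ n) (complexify N v) := by
    intro n
    induction n with
    | zero => simp
    | succ n ih =>
      intro v
      rw [pow_succ, pow_succ, Module.End.mul_apply, ContinuousLinearMap.mul_def,
        ContinuousLinearMap.comp_apply, ih]
      congr 1
      ext i
      simp [hA, hf, complexify, Matrix.mulVec, dotProduct]
  have h2 : v ∈ stableSubspace M ↔ complexify N v ∈ decaySubspace f := by
    rw [decaySubspace_eq]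
    · rfl
    · intro z hz
      refine hM z ?_
      rw [← Matrix.spectrum_toLin']
      exact hz.mem_spectrum
  have hinj : LinearMap.ker (complexify N) = ⊥ := by
    refine LinearMap.ker_eq_bot'.2 fun x hx ↦ ?_
    ext i
    simpa [complexify] using congrFun hx i
  -- Convergence to zero in ℝ^N is detected in ℂ^N.
  have h3 := (LinearMap.isClosedEmbedding_of_injective hinj).isInducing
  rw [h2, mem_decaySubspace, h3.tendsto_nhds_iff, map_zero]
  simp only [← h1]
  rfl

end StableSubspace

/-! ### The stable projection -/

section StableProjection

theorem continuous_ringInverse {B Z : Type*} [TopologicalSpace B] [NormedAddCommGroup Z]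
    [NormedSpace ℝ Z] [CompleteSpace Z] {T : B → Z →L[ℝ] Z} (hT : Continuous T)
    (hu : ∀ b, IsUnit (T b)) : Continuous fun b ↦ Ring.inverse (T b) :=
  continuous_iff_continuousAt.2 fun b ↦ ContinuousAt.comp (f := T) (g := Ring.inverse)
    (NormedRing.inverse_continuousAt (hu b).unit) hT.continuousAt

variable {N : ℕ}

/-- The operator `S - A` with constant coefficients. -/
def constOp (M : Matrix (Fin N) (Fin N) ℝ) : SeqSpace N →L[ℝ] SeqSpace N :=
  ZeroSeq.shift ℝ 1 - ZeroSeq.map (Matrix.toEuclideanCLM (n := Fin N) (𝕜 := ℝ) M)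

theorem constOp_apply (M : Matrix (Fin N) (Fin N) ℝ) (x : SeqSpace N) (n : ℤ) :
    constOp M x n = x (n + 1) - Matrix.toEuclideanCLM (n := Fin N) (𝕜 := ℝ) M (x n) := rfl

/-- The inverse of `S - A`. -/
def green (M : Matrix (Fin N) (Fin N) ℝ) : SeqSpace N →L[ℝ] SeqSpace N := Ring.inverse (constOp M)

variable {M : Matrix (Fin N) (Fin N) ℝ}

theorem constOp_green (hM : IsHyperbolic M) (y : SeqSpace N) : constOp M (green M y) = y :=
  DFunLike.congr_fun (Ring.mul_inverse_cancel _ (isUnit_shift_sub_map hM)) y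

theorem green_constOp (hM : IsHyperbolic M) (x : SeqSpace N) : green M (constOp M x) = x :=
  DFunLike.congr_fun (Ring.inverse_mul_cancel _ (isUnit_shift_sub_map hM)) x

theorem continuous_constOp :
    Continuous (constOp : Matrix (Fin N) (Fin N) ℝ → SeqSpace N →L[ℝ] SeqSpace N) := by
  refine continuous_const.sub (ZeroSeq.continuous_map.comp ?_)
  exact LinearMap.continuous_of_finiteDimensional
    ((Matrix.toEuclideanCLM (n := Fin N) (𝕜 := ℝ)).toAlgEquiv.toLinearMap)

theorem continuous_green {B : Type*} [TopologicalSpace B] {M : B → Matrix (Fin N) (Fin N) ℝ}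
    (hM : Continuous M) (hyp : ∀ b, IsHyperbolic (M b)) : Continuous fun b ↦ green (M b) :=
  continuous_ringInverse (continuous_constOp.comp hM) fun b ↦ isUnit_shift_sub_map (hyp b)

/-- A solution on the upper half-line is a forward orbit. -/
theorem eq_pow_apply_of_constOp_eq_zero {x : SeqSpace N} (hx : ∀ n : ℕ, constOp M x n = 0) (n : ℕ) :
    x n = (Matrix.toEuclideanCLM (n := Fin N) (𝕜 := ℝ) M ^ n) (x 0) := by
  induction n with
  | zero => simp
  | succ n ih =>
    have h1 := hx n
    rw [constOp_apply, sub_eq_zero] at h1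
    rw [pow_succ', ContinuousLinearMap.mul_def, ContinuousLinearMap.comp_apply, ← ih, ← h1]
    simp

theorem apply_zero_mem_stableSubspace (hM : IsHyperbolic M) {x : SeqSpace N}
    (hx : ∀ n : ℕ, constOp M x n = 0) : x 0 ∈ stableSubspace M := by
  rw [mem_stableSubspace_iff hM]
  exact (ZeroSeq.tendsto_natCast x).congr (eq_pow_apply_of_constOp_eq_zero hx)

/-- A solution on the upper half-line that starts at zero vanishes there. -/
theorem eq_zero_of_constOp_eq_zero {x : SeqSpace N} (hx : ∀ n : ℕ, constOp M x n = 0)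
    (h0 : x 0 = 0) {n : ℤ} (hn : 0 ≤ n) : x n = 0 := by
  obtain ⟨n, rfl⟩ := Int.eq_ofNat_of_zero_le hn
  rw [eq_pow_apply_of_constOp_eq_zero hx, h0, map_zero]

/-- The decaying forward orbit of v, extended by zero to negative places, solves the equation: its
only defect is the jump from 0 at -1 to v at 0. -/
theorem green_single_apply_of_neg (hM : IsHyperbolic M) {v : EuclideanSpace ℝ (Fin N)}
    (hv : v ∈ stableSubspace M) :
    (∀ n : ℤ, n < 0 → green M (ZeroSeq.single ℝ (-1) v) n = 0) ∧
      green M (ZeroSeq.single ℝ (-1) v) 0 = v := by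
  obtain ⟨x, hx, hx'⟩ := ZeroSeq.exists_of_tendsto ((mem_stableSubspace_iff hM).1 hv)
  have h0 : x 0 = v := by simpa using hx 0
  have h1 : constOp M x = ZeroSeq.single ℝ (-1) v := by
    ext1 n
    rw [constOp_apply]
    rcases lt_trichotomy n (-1) with hn | rfl | hn
    · rw [hx' n (by omega), hx' (n + 1) (by omega), ZeroSeq.single_apply_of_ne hn.ne]
      simp
    · rw [ZeroSeq.single_apply_self, hx' (-1) (by omega)]
      simpa using h0
    · obtain ⟨n, rfl⟩ := Int.eq_ofNat_of_zero_le (show 0 ≤ n by omega)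
      rw [ZeroSeq.single_apply_of_ne hn.ne']
      have h2 : x ((n : ℤ) + 1) = (Matrix.toEuclideanCLM (n := Fin N) (𝕜 := ℝ) M ^ (n + 1)) v :=
        hx (n + 1)
      change x ((n : ℤ) + 1) - _ = _
      rw [h2, pow_succ', ContinuousLinearMap.mul_def, ContinuousLinearMap.comp_apply]
      change _ - Matrix.toEuclideanCLM (n := Fin N) (𝕜 := ℝ) M (x (n : ℤ)) = 0
      rw [hx, sub_self]
  rw [← h1, green_constOp hM]
  exact ⟨hx', h0⟩

/-- The projection onto the stable subspace along the unstable subspace. -/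
def stableProj (M : Matrix (Fin N) (Fin N) ℝ) :
    EuclideanSpace ℝ (Fin N) →L[ℝ] EuclideanSpace ℝ (Fin N) :=
  ZeroSeq.eval ℝ 0 ∘L green M ∘L ZeroSeq.single ℝ (-1)

theorem stableProj_apply (v : EuclideanSpace ℝ (Fin N)) :
    stableProj M v = green M (ZeroSeq.single ℝ (-1) v) 0 := rfl

/-- The solution with source at -1 is homogeneous on n ≥ 0 and tends to zero, so its value at 0 is
stable. Norm continuity in the matrix comes from that of operator inversion. -/
theorem isProjectionFamily_stableProj {B : Type} [TopologicalSpace B]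
    {M : B → Matrix (Fin N) (Fin N) ℝ} (hM : Continuous M) (hyp : ∀ b, IsHyperbolic (M b)) :
    IsProjectionFamily (fun b ↦ stableProj (M b)) fun b ↦ stableSubspace (M b) where
  continuous := continuous_const.clm_comp ((continuous_green hM hyp).clm_comp continuous_const)
  apply_mem b v := apply_zero_mem_stableSubspace (hyp b) fun n ↦ by
    exact (DFunLike.congr_fun (constOp_green (hyp b) _) (n : ℤ)).trans
      (ZeroSeq.single_apply_of_ne (by omega) v)
  apply_eq b v hv := (green_single_apply_of_neg (hyp b) hv).2

end StableProjection

/-! ### Perturbations of transversal families -/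

section Perturbation

variable {B : Type} [TopologicalSpace B] {X Y : Type}
  [NormedAddCommGroup X] [NormedSpace ℝ X] [NormedAddCommGroup Y] [NormedSpace ℝ Y]

theorem HasClass.finiteDimensional {W : B → Submodule ℝ X} {x : Vect B} (h : HasClass W x) (b : B) :
    FiniteDimensional ℝ (W b) := by
  obtain ⟨E, ⟨φ, -⟩, rfl⟩ := h
  exact ((E.fiberModelEquiv b).symm.trans (φ b)).finiteDimensional

/-- 1 - RL and 1 - R'L' project onto the two preimages along the same complement, the common range
of R and R'. Restricted to the preimages they are mutually inverse. -/
theorem familyIso_comap_of_range_eq {L L' : B → X →L[ℝ] Y} {R R' : B → Y →L[ℝ] X}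
    {V : Submodule ℝ Y} (hL : Continuous L) (hL' : Continuous L') (hR : Continuous R)
    (hR' : Continuous R') (h : ∀ b, IsRightInverseMod (L b) V (R b))
    (h' : ∀ b, IsRightInverseMod (L' b) V (R' b)) (hRR : ∀ b, (R b).range = (R' b).range) :
    FamilyIso (fun b ↦ V.comap (L b : X →ₗ[ℝ] Y)) (fun b ↦ V.comap (L' b : X →ₗ[ℝ] Y)) := by
  have key : ∀ {l l' : X →L[ℝ] Y} {r r' : Y →L[ℝ] X}, IsRightInverseMod l V r →
      IsRightInverseMod l' V r' → r.range = r'.range → ∀ x ∈ V.comap (l : X →ₗ[ℝ] Y),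
        x - r' (l' x) - r (l (x - r' (l' x))) = x := by
    intro l l' r r' h h' hrr x hx
    obtain ⟨z, hz⟩ : r' (l' x) ∈ r.range := hrr ▸ ⟨l' x, rfl⟩
    have hz : r z = r' (l' x) := hz
    have h1 := h.apply_eq_zero _ (h.sub_mem z)
    rw [map_sub, sub_eq_zero] at h1
    rw [← hz, map_sub, map_sub, h1, h.comp_eq_zero hx]
    abel
  refine ⟨fun b ↦ 1 - R' b ∘L L' b, fun b ↦ 1 - R b ∘L L b, continuous_const.sub (hR'.clm_comp hL'),
    continuous_const.sub (hR.clm_comp hL), fun b ↦ ⟨fun x hx ↦ ⟨(h' b).comp_sub_mem x, ?_⟩,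
      fun x hx ↦ ⟨(h b).comp_sub_mem x, ?_⟩⟩⟩
  · exact key (h b) (h' b) (hRR b) x hx
  · exact key (h' b) (h b) (hRR b).symm x hx

theorem range_comp_inverse [CompleteSpace Y] {R : Y →L[ℝ] X} {M : Y →L[ℝ] Y} (hM : IsUnit M) :
    R.range = (R ∘L Ring.inverse M).range := by
  refine le_antisymm ?_ ?_
  · rintro _ ⟨y, rfl⟩
    refine ⟨M y, ?_⟩
    exact congrArg R (DFunLike.congr_fun (Ring.inverse_mul_cancel _ hM) y)
  · rintro _ ⟨y, rfl⟩
    exact ⟨Ring.inverse M y, rfl⟩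

variable [CompleteSpace X] [CompleteSpace Y] [CompactSpace B] [T2Space B] [ConnectedSpace B]

/-- The index bundle does not change if the family changes only by terms with values in a
transversal subspace. -/
theorem IsIndexBundle.congr_of_sub_mem {L L' : B → X →L[ℝ] Y} {η : KO B} (h : IsIndexBundle L η)
    (hL' : Continuous L') {V : Submodule ℝ Y} [FiniteDimensional ℝ V]
    (hV : ∀ b, (L b).range ⊔ V = ⊤) (hsub : ∀ b x, L' b x - L b x ∈ V) : IsIndexBundle L' η := by
  -- The two families agree modulo `V`, so the preimages of `V` are equal, and a right inverse
  -- modulo `V` of one family serves the other.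
  have hcomap : ∀ b, V.comap (L b : X →ₗ[ℝ] Y) = V.comap (L' b : X →ₗ[ℝ] Y) := fun b ↦ by
    ext x
    exact ⟨fun hx ↦ by simpa using V.add_mem (hsub b x) hx,
      fun hx ↦ by simpa using V.sub_mem hx (hsub b x)⟩
  have hR : ∀ b, ∃ R, IsRightInverseMod (L' b) V R := fun b ↦ by
    obtain ⟨R, hR⟩ := (h.isFredholm b).exists_isRightInverseMod V (hV b)
    exact ⟨R, fun y ↦ by simpa using V.add_mem (hsub b (R y)) (hR.sub_mem y), hR.apply_eq_zero⟩
  choose R hR using hR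
  obtain ⟨hE, hη⟩ := h.eq_of_transversal V hV
  rw [hη]
  have hE' := hE.hasClass
  generalize hE.toVect = x at hE'
  simp only [hcomap] at hE'
  refine IsIndexBundle.of_hasClass hL' (fun b ↦ (hR b).isFredholm ?_)
    (fun b ↦ (hR b).sup_eq_top) hE'
  rw [← hcomap]
  exact (h.isFredholm b).finiteDimensional_comap V

end Perturbation

/-! ### Operators with coefficients that are constant on half-lines -/

section StepOperator

theorem Continuous.clm_prodMk {B X E F : Type*} [TopologicalSpace B] [NormedAddCommGroup X]
    [NormedSpace ℝ X] [NormedAddCommGroup E] [NormedSpace ℝ E] [NormedAddCommGroup F]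
    [NormedSpace ℝ F] {f : B → X →L[ℝ] E} {g : B → X →L[ℝ] F} (hf : Continuous f)
    (hg : Continuous g) : Continuous fun b ↦ (f b).prod (g b) := by
  have h : ∀ b, (f b).prod (g b) = ContinuousLinearMap.inl ℝ E F ∘L f b +
      ContinuousLinearMap.inr ℝ E F ∘L g b := fun b ↦ by ext x <;> simp
  simp only [h]
  exact (continuous_const.clm_comp hf).add (continuous_const.clm_comp hg)

theorem Continuous.clm_coprod {B X E F : Type*} [TopologicalSpace B] [NormedAddCommGroup X]
    [NormedSpace ℝ X] [NormedAddCommGroup E] [NormedSpace ℝ E] [NormedAddCommGroup F]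
    [NormedSpace ℝ F] {f : B → E →L[ℝ] X} {g : B → F →L[ℝ] X} (hf : Continuous f)
    (hg : Continuous g) : Continuous fun b ↦ (f b).coprod (g b) := by
  have h : ∀ b, (f b).coprod (g b) = f b ∘L ContinuousLinearMap.fst ℝ E F +
      g b ∘L ContinuousLinearMap.snd ℝ E F := fun b ↦ by ext x <;> simp
  simp only [h]
  exact (hf.clm_comp continuous_const).add (hg.clm_comp continuous_const)

variable {N : ℕ}

/-- The operator `S - A` with the coefficient `P` at the places `n ≥ 0` and `M` at `n < 0`. -/
def stepOp (P M : Matrix (Fin N) (Fin N) ℝ) : SeqSpace N →L[ℝ] SeqSpace N :=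
  ZeroSeq.cutoff ℝ {n | 0 ≤ n} ∘L constOp P + ZeroSeq.cutoff ℝ {n | n < 0} ∘L constOp M

/-- A right inverse of `stepOp P M` modulo the sequences supported at `-1`. -/
def stepInv (P M : Matrix (Fin N) (Fin N) ℝ) : SeqSpace N →L[ℝ] SeqSpace N :=
  ZeroSeq.cutoff ℝ {n | 0 ≤ n} ∘L green P ∘L ZeroSeq.cutoff ℝ {n | 0 ≤ n} +
    -- The source at -1 is dropped: the equation at that place is the only one that joins x₋₁ to x₀,
    -- and it is void modulo sequences supported at -1.
    ZeroSeq.cutoff ℝ {n | n < 0} ∘L green M ∘L ZeroSeq.cutoff ℝ {n | n < -1}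

variable {P M : Matrix (Fin N) (Fin N) ℝ}

theorem cutoff_add_cutoff_apply (x y : SeqSpace N) (n : ℤ) :
    (ZeroSeq.cutoff ℝ {n | 0 ≤ n} x + ZeroSeq.cutoff ℝ {n | n < 0} y) n =
      if 0 ≤ n then x n else y n := by
  rw [ZeroAtInftyContinuousMap.add_apply, ZeroSeq.cutoff_apply, ZeroSeq.cutoff_apply]
  by_cases h : 0 ≤ n
  · simp [h, not_lt.2 h]
  · simp [h, not_le.1 h]

theorem stepOp_apply (x : SeqSpace N) (n : ℤ) :
    stepOp P M x n = if 0 ≤ n then constOp P x n else constOp M x n :=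
  cutoff_add_cutoff_apply _ _ n

theorem stepInv_apply (y : SeqSpace N) (n : ℤ) :
    stepInv P M y n = if 0 ≤ n then green P (ZeroSeq.cutoff ℝ {n | 0 ≤ n} y) n
      else green M (ZeroSeq.cutoff ℝ {n | n < -1} y) n :=
  cutoff_add_cutoff_apply _ _ n

/-- The sequences supported at `-1`. -/
def singleRange (N : ℕ) : Submodule ℝ (SeqSpace N) :=
  (ZeroSeq.single ℝ (-1) : EuclideanSpace ℝ (Fin N) →L[ℝ] SeqSpace N).range

instance : FiniteDimensional ℝ (singleRange N) := by
  unfold singleRange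
  infer_instance

theorem mem_singleRange_iff {y : SeqSpace N} : y ∈ singleRange N ↔ ∀ n, n ≠ -1 → y n = 0 := by
  constructor
  · rintro ⟨v, rfl⟩ n hn
    exact ZeroSeq.single_apply_of_ne hn v
  · intro h
    refine ⟨y (-1), ?_⟩
    ext1 n
    by_cases hn : n = -1
    · subst hn
      exact ZeroSeq.single_apply_self _ _
    · rw [h n hn]
      exact ZeroSeq.single_apply_of_ne hn _

theorem isRightInverseMod_stepInv (hP : IsHyperbolic P) (hM : IsHyperbolic M) :
    IsRightInverseMod (stepOp P M) (singleRange N) (stepInv P M) := by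
  refine ⟨fun y ↦ mem_singleRange_iff.2 fun n hn ↦ ?_, fun v hv ↦ ?_⟩
  · rw [ZeroAtInftyContinuousMap.sub_apply, sub_eq_zero, stepOp_apply]
    by_cases h : 0 ≤ n
    · rw [if_pos h, constOp_apply, stepInv_apply, stepInv_apply, if_pos h, if_pos (by omega),
        ← constOp_apply, constOp_green hP]
      exact ZeroSeq.cutoff_apply_of_mem y h
    · have h' : n < -1 := by omega
      rw [if_neg h, constOp_apply, stepInv_apply, stepInv_apply, if_neg h, if_neg (by omega),
        ← constOp_apply, constOp_green hM]
      exact ZeroSeq.cutoff_apply_of_mem y h'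
  · rw [mem_singleRange_iff] at hv
    have h1 : ZeroSeq.cutoff ℝ {n | 0 ≤ n} v = 0 := by
      ext1 n
      rw [ZeroSeq.cutoff_apply]
      split_ifs with h
      · exact hv n (by simp at h; omega)
      · rfl
    have h2 : ZeroSeq.cutoff ℝ {n | n < -1} v = 0 := by
      ext1 n
      rw [ZeroSeq.cutoff_apply]
      split_ifs with h
      · exact hv n (by simp at h; omega)
      · rfl
    ext1 n
    rw [stepInv_apply, h1, h2, map_zero, map_zero, ite_self]

theorem mem_comap_stepOp_iff {x : SeqSpace N} :
    x ∈ (singleRange N).comap (stepOp P M : SeqSpace N →ₗ[ℝ] SeqSpace N) ↔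
      (∀ n : ℤ, 0 ≤ n → constOp P x n = 0) ∧ ∀ n : ℤ, n < -1 → constOp M x n = 0 := by
  refine (mem_singleRange_iff (y := stepOp P M x)).trans ?_
  simp only [stepOp_apply]
  constructor
  · intro h
    refine ⟨fun n hn ↦ ?_, fun n hn ↦ ?_⟩
    · have := h n (by omega)
      rwa [if_pos hn] at this
    · have := h n (by omega)
      rwa [if_neg (by omega)] at this
  · rintro ⟨h1, h2⟩ n hn
    split_ifs with h
    · exact h1 n h
    · exact h2 n (by omega)

/-- The cut-off sequence jumps from 0 to x₀ between the places -1 and 0, so S - P maps it to δ₋₁x₀.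
-/
theorem green_single_of_mem (hP : IsHyperbolic P) {x : SeqSpace N}
    (hx : ∀ n : ℤ, 0 ≤ n → constOp P x n = 0) :
    green P (ZeroSeq.single ℝ (-1) (x 0)) = ZeroSeq.cutoff ℝ {n | 0 ≤ n} x := by
  rw [← green_constOp hP (ZeroSeq.cutoff ℝ {n | 0 ≤ n} x)]
  congr 1
  ext1 n
  rw [constOp_apply, ZeroSeq.cutoff_apply, ZeroSeq.cutoff_apply, ZeroSeq.single_apply]
  simp only [Set.mem_ofPred_eq]
  rcases lt_trichotomy n (-1) with hn | rfl | hn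
  · rw [if_neg (by omega), if_neg (by omega), if_neg (by omega), map_zero, sub_zero]
  · simp
  · rw [if_neg (by omega), if_pos (by omega), if_pos (by omega), ← constOp_apply, hx n (by omega)]

/-- After the cut-off the value at 0 is zero, so the equation at -1 leaves -Mx₋₁; this explains the
sign and the factor M. -/
theorem green_single_of_mem_neg (hM : IsHyperbolic M) {x : SeqSpace N}
    (hx : ∀ n : ℤ, n < -1 → constOp M x n = 0) :
    green M (ZeroSeq.single ℝ (-1) (Matrix.toEuclideanCLM (n := Fin N) (𝕜 := ℝ) M (x (-1)))) =
      -ZeroSeq.cutoff ℝ {n | n < 0} x := by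
  rw [← green_constOp hM (ZeroSeq.cutoff ℝ {n | n < 0} x), ← map_neg]
  congr 1
  ext1 n
  rw [ZeroAtInftyContinuousMap.neg_apply, constOp_apply, ZeroSeq.cutoff_apply, ZeroSeq.cutoff_apply,
    ZeroSeq.single_apply]
  simp only [Set.mem_ofPred_eq]
  rcases lt_trichotomy n (-1) with hn | rfl | hn
  · rw [if_neg (by omega), if_pos (by omega), if_pos (by omega), ← constOp_apply, hx n hn, neg_zero]
  · simp
  · rw [if_neg (by omega), if_neg (by omega), if_neg (by omega), map_zero, sub_zero, neg_zero]

/-- The boundary values of a sequence on the two half-lines. -/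
def boundaryMap (M : Matrix (Fin N) (Fin N) ℝ) :
    SeqSpace N →L[ℝ] EuclideanSpace ℝ (Fin N) × EuclideanSpace ℝ (Fin N) :=
  -- The second value is Mx₋₁, the continuation to place 0 of the solution on the negative
  -- half-line.
  (ZeroSeq.eval ℝ 0).prod (Matrix.toEuclideanCLM (n := Fin N) (𝕜 := ℝ) M ∘L ZeroSeq.eval ℝ (-1))

/-- The homogeneous solution on the two half-lines with given boundary values. -/
def solutionMap (P M : Matrix (Fin N) (Fin N) ℝ) :
    EuclideanSpace ℝ (Fin N) × EuclideanSpace ℝ (Fin N) →L[ℝ] SeqSpace N :=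
  (green P ∘L ZeroSeq.single ℝ (-1)).coprod (-(green M ∘L ZeroSeq.single ℝ (-1)))

theorem boundaryMap_apply (x : SeqSpace N) :
    boundaryMap M x = (x 0, Matrix.toEuclideanCLM (n := Fin N) (𝕜 := ℝ) M (x (-1))) := rfl

theorem solutionMap_apply (s u : EuclideanSpace ℝ (Fin N)) :
    solutionMap P M (s, u) =
      green P (ZeroSeq.single ℝ (-1) s) - green M (ZeroSeq.single ℝ (-1) u) :=
  (sub_eq_add_neg _ _).symm

theorem boundaryMap_mem (hP : IsHyperbolic P) (hM : IsHyperbolic M) {x : SeqSpace N}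
    (hx : x ∈ (singleRange N).comap (stepOp P M : SeqSpace N →ₗ[ℝ] SeqSpace N)) :
    boundaryMap M x ∈ (stableSubspace P).prod (stableProj M).ker ∧
      solutionMap P M (boundaryMap M x) = x := by
  obtain ⟨h1, h2⟩ := mem_comap_stepOp_iff.1 hx
  have h3 := green_single_of_mem hP h1
  have h4 := green_single_of_mem_neg hM h2
  rw [boundaryMap_apply, solutionMap_apply, h3, h4]
  refine ⟨⟨apply_zero_mem_stableSubspace hP fun n ↦ h1 n (by positivity), ?_⟩, ?_⟩
  · change stableProj M _ = 0
    rw [stableProj_apply, h4, ZeroAtInftyContinuousMap.neg_apply,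
      ZeroSeq.cutoff_apply_of_notMem _ (by simp), neg_zero]
  · rw [sub_neg_eq_add]
    ext1 n
    rw [cutoff_add_cutoff_apply, ite_self]

/-- For s stable the solution p lives on n ≥ 0. For u in the kernel of the stable projection, q has
value zero at 0 and then vanishes on n ≥ 0. The two do not overlap, so p - q is a homogeneous
solution on each half-line. -/
theorem solutionMap_mem (hP : IsHyperbolic P) (hM : IsHyperbolic M)
    {w : EuclideanSpace ℝ (Fin N) × EuclideanSpace ℝ (Fin N)}
    (hw : w ∈ (stableSubspace P).prod (stableProj M).ker) :
    solutionMap P M w ∈ (singleRange N).comap (stepOp P M : SeqSpace N →ₗ[ℝ] SeqSpace N) ∧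
      boundaryMap M (solutionMap P M w) = w := by
  obtain ⟨s, u⟩ := w
  obtain ⟨hs, hu⟩ := hw
  obtain ⟨h1, h2⟩ := green_single_apply_of_neg hP hs
  have h3 : ∀ n, n ≠ -1 → constOp P (green P (ZeroSeq.single ℝ (-1) s)) n = 0 :=
    fun n hn ↦ by rw [constOp_green hP, ZeroSeq.single_apply_of_ne hn]
  have h4 : ∀ n, constOp M (green M (ZeroSeq.single ℝ (-1) u)) n =
    ZeroSeq.single ℝ (-1) u n := fun n ↦ by rw [constOp_green hM]
  have h5 : green M (ZeroSeq.single ℝ (-1) u) 0 = 0 := hu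
  rw [solutionMap_apply, mem_comap_stepOp_iff, boundaryMap_apply]
  set p := green P (ZeroSeq.single ℝ (-1) s)
  set q := green M (ZeroSeq.single ℝ (-1) u)
  have h6 : ∀ n : ℤ, 0 ≤ n → q n = 0 := fun n hn ↦
    eq_zero_of_constOp_eq_zero
      (fun n ↦ by rw [h4, ZeroSeq.single_apply_of_ne (by omega)]) h5 hn
  have h7 := h4 (-1)
  rw [constOp_apply, ZeroSeq.single_apply_self, neg_add_cancel, h5, zero_sub] at h7
  have h8 : ∀ n, (p - q) n = p n - q n := fun _ ↦ rfl
  refine ⟨⟨fun n hn ↦ ?_, fun n hn ↦ ?_⟩, Prod.ext ?_ ?_⟩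
  · rw [constOp_apply, h8, h8, h6 n hn, h6 (n + 1) (by omega), sub_zero, sub_zero,
      ← constOp_apply, h3 n (by omega)]
  · rw [constOp_apply, h8, h8, h1 n (by omega), h1 (n + 1) (by omega), zero_sub, zero_sub, map_neg]
    have h9 := h4 n
    rw [constOp_apply, ZeroSeq.single_apply_of_ne (by omega)] at h9
    rw [← neg_sub', h9, neg_zero]
  · change (p - q) 0 = s
    rw [h8, h2, h5, sub_zero]
  · change Matrix.toEuclideanCLM (n := Fin N) (𝕜 := ℝ) M ((p - q) (-1)) = u
    rw [h8, h1 (-1) (by omega), zero_sub, map_neg, h7]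

theorem continuous_toEuclideanCLM :
    Continuous (Matrix.toEuclideanCLM (n := Fin N) (𝕜 := ℝ)) :=
  LinearMap.continuous_of_finiteDimensional
    ((Matrix.toEuclideanCLM (n := Fin N) (𝕜 := ℝ)).toAlgEquiv.toLinearMap)

theorem familyIso_comap_stepOp {B : Type} [TopologicalSpace B]
    {P M : B → Matrix (Fin N) (Fin N) ℝ} (hP : Continuous P) (hM : Continuous M)
    (hypP : ∀ b, IsHyperbolic (P b)) (hypM : ∀ b, IsHyperbolic (M b)) :
    FamilyIso (fun b ↦ (singleRange N).comap (stepOp (P b) (M b) : SeqSpace N →ₗ[ℝ] SeqSpace N))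
      (fun b ↦ (stableSubspace (P b)).prod (stableProj (M b)).ker) := by
  refine ⟨fun b ↦ boundaryMap (M b), fun b ↦ solutionMap (P b) (M b), ?_, ?_,
    fun b ↦ ⟨fun x hx ↦ boundaryMap_mem (hypP b) (hypM b) hx,
      fun w hw ↦ solutionMap_mem (hypP b) (hypM b) hw⟩⟩
  · exact continuous_const.clm_prodMk
      ((continuous_toEuclideanCLM.comp hM).clm_comp continuous_const)
  · exact ((continuous_green hP hypP).clm_comp continuous_const).clm_coprod
      ((continuous_green hM hypM).clm_comp continuous_const).neg

theorem familyIso_singleRange {B : Type} [TopologicalSpace B] :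
    FamilyIso (fun _ : B ↦ singleRange N) (fun _ ↦ (⊤ : Submodule ℝ (EuclideanSpace ℝ (Fin N)))) := by
  have h : ∀ v : EuclideanSpace ℝ (Fin N), ZeroSeq.eval ℝ (-1) (ZeroSeq.single ℝ (-1) v) = v :=
    fun v ↦ by rw [ZeroSeq.eval_apply, ZeroSeq.single_apply_self]
  refine ⟨fun _ ↦ ZeroSeq.eval ℝ (-1), fun _ ↦ ZeroSeq.single ℝ (-1), continuous_const,
    continuous_const, fun _ ↦ ⟨?_, fun v _ ↦ ⟨⟨v, rfl⟩, h v⟩⟩⟩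
  rintro _ ⟨v, rfl⟩
  exact ⟨trivial, congrArg (ZeroSeq.single ℝ (-1)) (h v)⟩

/-- The range and the kernel of a projection span the ambient space. -/
theorem IsProjectionFamily.familyIso_prod_ker {B X : Type} [TopologicalSpace B]
    [NormedAddCommGroup X] [NormedSpace ℝ X] {P : B → X →L[ℝ] X} {W : B → Submodule ℝ X}
    (h : IsProjectionFamily P W) :
    FamilyIso (fun b ↦ (W b).prod (P b).ker) (fun _ ↦ (⊤ : Submodule ℝ X)) := by
  refine ⟨fun _ ↦ (ContinuousLinearMap.id ℝ X).coprod (ContinuousLinearMap.id ℝ X),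
    fun b ↦ (P b).prod (1 - P b), continuous_const,
    h.continuous.clm_prodMk (continuous_const.sub h.continuous),
    fun b ↦ ⟨fun ⟨s, u⟩ ⟨hs, hu⟩ ↦ ⟨trivial, ?_⟩, fun x _ ↦ ⟨⟨h.apply_mem b x, ?_⟩, ?_⟩⟩⟩
  · have hu : P b u = 0 := hu
    have hs : P b s = s := h.apply_eq b s hs
    simp [hs, hu]
  · change P b (x - P b x) = 0
    rw [map_sub, h.apply_eq b _ (h.apply_mem b x), sub_self]
  · simp

theorem IsProjectionFamily.ker {B X : Type} [TopologicalSpace B]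
    [NormedAddCommGroup X] [NormedSpace ℝ X] {P : B → X →L[ℝ] X} {W : B → Submodule ℝ X}
    (h : IsProjectionFamily P W) : IsProjectionFamily (fun b ↦ 1 - P b) fun b ↦ (P b).ker where
  continuous := continuous_const.sub h.continuous
  apply_mem b x := by
    change P b (x - P b x) = 0
    rw [map_sub, h.apply_eq b _ (h.apply_mem b x), sub_self]
  apply_eq b x hx := by
    have hx : P b x = 0 := hx
    simp [hx]

theorem continuous_stepOp {B : Type} [TopologicalSpace B]
    {P M : B → Matrix (Fin N) (Fin N) ℝ} (hP : Continuous P) (hM : Continuous M) :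
    Continuous fun b ↦ stepOp (P b) (M b) :=
  (continuous_const.clm_comp (continuous_constOp.comp hP)).add
    (continuous_const.clm_comp (continuous_constOp.comp hM))

theorem continuous_stepInv {B : Type} [TopologicalSpace B]
    {P M : B → Matrix (Fin N) (Fin N) ℝ} (hP : Continuous P) (hM : Continuous M)
    (hypP : ∀ b, IsHyperbolic (P b)) (hypM : ∀ b, IsHyperbolic (M b)) :
    Continuous fun b ↦ stepInv (P b) (M b) :=
  (continuous_const.clm_comp ((continuous_green hP hypP).clm_comp continuous_const)).add
    (continuous_const.clm_comp ((continuous_green hM hypM).clm_comp continuous_const))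

end StepOperator

/-! ### Asymptotically hyperbolic families -/

section OperatorFamilies

variable {B X Y : Type*} [TopologicalSpace B] [NormedAddCommGroup X] [NormedSpace ℝ X]
  [NormedAddCommGroup Y] [NormedSpace ℝ Y]

theorem continuous_of_exists_norm_sub_le {L : B → X →L[ℝ] Y}
    (h : ∀ ε > 0, ∃ K : B → X →L[ℝ] Y, Continuous K ∧ ∀ b, ‖L b - K b‖ ≤ ε) : Continuous L := by
  refine continuous_of_uniform_approx_of_continuous fun u hu ↦ ?_
  obtain ⟨ε, hε, hu⟩ := Metric.mem_uniformity_dist.1 hu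
  obtain ⟨K, hK, hLK⟩ := h (ε / 2) (half_pos hε)
  refine ⟨K, hK, fun b ↦ hu ?_⟩
  rw [dist_eq_norm]
  exact (hLK b).trans_lt (half_lt_self hε)

theorem Continuous.clm_finsetSum {ι : Type*} {s : Finset ι} {f : ι → B → X →L[ℝ] Y}
    (h : ∀ i, Continuous (f i)) : Continuous fun b ↦ ∑ i ∈ s, f i b :=
  continuous_finsetSum _ fun i _ ↦ h i

theorem Continuous.clm_add {f g : B → X →L[ℝ] Y} (hf : Continuous f) (hg : Continuous g) :
    Continuous fun b ↦ f b + g b := hf.add hg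

theorem Continuous.clm_sub {f g : B → X →L[ℝ] Y} (hf : Continuous f) (hg : Continuous g) :
    Continuous fun b ↦ f b - g b := hf.sub hg

theorem exists_norm_clm_le [CompactSpace B] {R : B → X →L[ℝ] Y} (hR : Continuous R) :
    ∃ C, 0 ≤ C ∧ ∀ b, ‖R b‖ ≤ C := by
  obtain ⟨C, hC⟩ := isCompact_univ.exists_bound_of_continuousOn hR.continuousOn
  exact ⟨max C 0, le_max_right _ _, fun b ↦ (hC b trivial).trans (le_max_left _ _)⟩

theorem isUnit_one_add_comp [CompleteSpace Y] {D : X →L[ℝ] Y} {R : Y →L[ℝ] X}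
    {d c : ℝ} (hD : ‖D‖ ≤ d) (hR : ‖R‖ ≤ c) (h : d * c < 1) : IsUnit (1 + D ∘L R) := by
  have h1 : ‖-(D ∘L R)‖ < 1 := by
    rw [norm_neg]
    exact ((ContinuousLinearMap.opNorm_comp_le _ _).trans (mul_le_mul hD hR (norm_nonneg _)
      ((norm_nonneg _).trans hD))).trans_lt h
  have h2 := isUnit_one_sub_of_norm_lt_one h1
  rwa [sub_neg_eq_add] at h2

end OperatorFamilies

/-! ### Comparison with the step operator: small tails and a finite block -/

section AsymptoticallyHyperbolic

variable {N : ℕ}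

/-- The places outside of `[-m, m)`. -/
def tailSet (m : ℕ) : Set ℤ := {n | n < -m ∨ m ≤ n}

/-- The sequences supported in `[-m, m)`. -/
def coreSubspace (N m : ℕ) : Submodule ℝ (SeqSpace N) where
  carrier := {x | ∀ n ∈ tailSet m, x n = 0}
  add_mem' h h' n hn := by
    rw [ZeroAtInftyContinuousMap.add_apply, h n hn, h' n hn, add_zero]
  zero_mem' _ _ := rfl
  smul_mem' c x h n hn := by rw [ZeroAtInftyContinuousMap.smul_apply, h n hn, smul_zero]

instance (m : ℕ) : FiniteDimensional ℝ (coreSubspace N m) := by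
  let f : coreSubspace N m →ₗ[ℝ] (Finset.Ico (-m : ℤ) m → EuclideanSpace ℝ (Fin N)) :=
    { toFun := fun x n ↦ (x : SeqSpace N) n
      map_add' := fun _ _ ↦ rfl
      map_smul' := fun _ _ ↦ rfl }
  refine FiniteDimensional.of_injective f fun x y hxy ↦ Subtype.ext ?_
  ext1 n
  by_cases hn : n ∈ Finset.Ico (-m : ℤ) m
  · exact congrFun hxy ⟨n, hn⟩
  · have hn' : n ∈ tailSet m := by
      simp only [Finset.mem_Ico, not_and, not_lt] at hn
      by_cases h : n < -m
      · exact Or.inl h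
      · exact Or.inr (hn (not_lt.1 h))
    rw [x.2 n hn', y.2 n hn']

theorem singleRange_le_coreSubspace {m : ℕ} (hm : 1 ≤ m) : singleRange N ≤ coreSubspace N m := by
  intro x hx n hn
  refine mem_singleRange_iff.1 hx n ?_
  rintro rfl
  rcases hn with h | h <;> omega

theorem differenceOp_sub_stepOp_apply {a : ℤ → Matrix (Fin N) (Fin N) ℝ} (ha : IsBoundedSeq a)
    (P M : Matrix (Fin N) (Fin N) ℝ) (x : SeqSpace N) (n : ℤ) :
    (differenceOp a ha - stepOp P M) x n =
      Matrix.toEuclideanCLM (n := Fin N) (𝕜 := ℝ) ((if 0 ≤ n then P else M) - a n) (x n) := by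
  change differenceOp a ha x n - stepOp P M x n = _
  have h : differenceOp a ha x n =
    x (n + 1) - Matrix.toEuclideanCLM (n := Fin N) (𝕜 := ℝ) (a n) (x n) := rfl
  rw [h, stepOp_apply, map_sub]
  split_ifs
  all_goals
    rw [constOp_apply]
    exact sub_sub_sub_cancel_left _ _ _

theorem norm_cutoff_comp_le {a : ℤ → Matrix (Fin N) (Fin N) ℝ} (ha : IsBoundedSeq a)
    {P M : Matrix (Fin N) (Fin N) ℝ} {ε : ℝ} (hε : 0 ≤ ε) {m : ℕ}
    (h : ∀ n ∈ tailSet m,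
      ‖Matrix.toEuclideanCLM (n := Fin N) (𝕜 := ℝ) ((if 0 ≤ n then P else M) - a n)‖ ≤ ε) :
    ‖ZeroSeq.cutoff ℝ (tailSet m) ∘L (differenceOp a ha - stepOp P M)‖ ≤ ε := by
  refine ContinuousLinearMap.opNorm_le_bound _ hε fun x ↦ ZeroSeq.norm_le (by positivity) fun n ↦ ?_
  rw [ContinuousLinearMap.comp_apply, ZeroSeq.cutoff_apply]
  split_ifs with hn
  · rw [differenceOp_sub_stepOp_apply]
    exact (ContinuousLinearMap.le_of_opNorm_le _ (h n hn) _).trans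
      (mul_le_mul_of_nonneg_left (ZeroSeq.norm_apply_le x n) hε)
  · rw [norm_zero]
    positivity

/-- The approximation of `differenceOp` that has the true coefficients in `[-m, m)` only. -/
def coreApprox (a : ℤ → Matrix (Fin N) (Fin N) ℝ) (P M : Matrix (Fin N) (Fin N) ℝ) (m : ℕ) :
    SeqSpace N →L[ℝ] SeqSpace N :=
  stepOp P M + ∑ n ∈ Finset.Ico (-m : ℤ) m, ZeroSeq.single ℝ n ∘L
    Matrix.toEuclideanCLM (n := Fin N) (𝕜 := ℝ) ((if 0 ≤ n then P else M) - a n) ∘L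
      ZeroSeq.eval ℝ n

theorem differenceOp_sub_coreApprox {a : ℤ → Matrix (Fin N) (Fin N) ℝ} (ha : IsBoundedSeq a)
    (P M : Matrix (Fin N) (Fin N) ℝ) (m : ℕ) :
    differenceOp a ha - coreApprox a P M m =
      ZeroSeq.cutoff ℝ (tailSet m) ∘L (differenceOp a ha - stepOp P M) := by
  ext1 x
  ext1 k
  have h1 : ∀ f : ℤ → SeqSpace N →L[ℝ] SeqSpace N, ∀ s : Finset ℤ,
      (∑ n ∈ s, f n) x k = ∑ n ∈ s, f n x k := fun f s ↦ by
    induction s using Finset.cons_induction with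
    | empty => rfl
    | cons n s hn ih =>
      rw [Finset.sum_cons, Finset.sum_cons, ← ih]
      rfl
  have h2 : (differenceOp a ha - coreApprox a P M m) x k =
    (differenceOp a ha - stepOp P M) x k - (∑ n ∈ Finset.Ico (-m : ℤ) m, ZeroSeq.single ℝ n ∘L
      Matrix.toEuclideanCLM (n := Fin N) (𝕜 := ℝ) ((if 0 ≤ n then P else M) - a n) ∘L
        ZeroSeq.eval ℝ n) x k := sub_add_eq_sub_sub (differenceOp a ha x k) (stepOp P M x k) _
  rw [h2, h1, ContinuousLinearMap.comp_apply, ZeroSeq.cutoff_apply]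
  have h3 : ∀ n, (ZeroSeq.single ℝ n ∘L
        Matrix.toEuclideanCLM (n := Fin N) (𝕜 := ℝ) ((if 0 ≤ n then P else M) - a n) ∘L
          ZeroSeq.eval ℝ n) x k = if k = n then (differenceOp a ha - stepOp P M) x k else 0 := by
    intro n
    rw [differenceOp_sub_stepOp_apply]
    rw [ContinuousLinearMap.comp_apply, ContinuousLinearMap.comp_apply, ZeroSeq.eval_apply,
      ZeroSeq.single_apply]
    by_cases h : k = n
    · subst h; rfl
    · rw [if_neg h, if_neg h]
  simp only [h3, Finset.sum_ite_eq]
  have h4 : k ∈ tailSet m ↔ k ∉ Finset.Ico (-m : ℤ) m := by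
    simp only [tailSet, Set.mem_ofPred_eq, Finset.mem_Ico, not_and_or, not_le, not_lt]
  by_cases h : k ∈ Finset.Ico (-m : ℤ) m
  · rw [if_pos h, if_neg (by rw [h4]; exact not_not.2 h), sub_self]
  · rw [if_neg h, if_pos (h4.2 h), sub_zero]

variable {B : Type} [TopologicalSpace B] {a : ℤ → B → Matrix (Fin N) (Fin N) ℝ}
  {P M : B → Matrix (Fin N) (Fin N) ℝ}

omit [TopologicalSpace B] in
theorem exists_forall_tailSet_norm_le (hP : TendstoUniformly a P atTop)
    (hM : TendstoUniformly a M atBot) {ε : ℝ} (hε : 0 < ε) :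
    ∃ m₀ : ℕ, ∀ m ≥ m₀, ∀ b, ∀ n ∈ tailSet m,
      ‖Matrix.toEuclideanCLM (n := Fin N) (𝕜 := ℝ) ((if 0 ≤ n then P b else M b) - a n b)‖ ≤ ε := by
  have huc : UniformContinuous (Matrix.toEuclideanCLM (n := Fin N) (𝕜 := ℝ)) :=
    uniformContinuous_addMonoidHom_of_continuous continuous_toEuclideanCLM
  have h1 := Metric.tendstoUniformly_iff.1 (huc.comp_tendstoUniformly hP) ε hε
  have h2 := Metric.tendstoUniformly_iff.1 (huc.comp_tendstoUniformly hM) ε hε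
  obtain ⟨k, hk⟩ := eventually_atTop.1 h1
  obtain ⟨l, hl⟩ := eventually_atBot.1 h2
  -- This makes m ≥ k and -m ≤ l, so each tail lies where the corresponding limit is already
  -- ε-close.
  refine ⟨k.toNat + (-l).toNat, fun m hm b n hn ↦ ?_⟩
  rw [map_sub, ← dist_eq_norm]
  rcases hn with hn | hn
  · rw [if_neg (by omega)]
    exact (hl n (by omega) b).le
  · rw [if_pos (by omega)]
    exact (hk n (by omega) b).le

/-- The operators with true coefficients only in [-m, m) depend continuously on the parameter, being
finite sums, and they approximate the family uniformly in norm. -/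
theorem continuous_differenceOp (hac : ∀ n, Continuous (a n)) (hP : TendstoUniformly a P atTop)
    (hM : TendstoUniformly a M atBot) (hPc : Continuous P) (hMc : Continuous M)
    (hb : ∀ b, IsBoundedSeq fun n ↦ a n b) :
    Continuous fun b ↦ differenceOp (fun n ↦ a n b) (hb b) := by
  refine continuous_of_exists_norm_sub_le fun ε hε ↦ ?_
  obtain ⟨m, hm⟩ := exists_forall_tailSet_norm_le hP hM hε
  refine ⟨fun b ↦ coreApprox (fun n ↦ a n b) (P b) (M b) m, ?_, fun b ↦ ?_⟩
  · refine (continuous_stepOp hPc hMc).clm_add (Continuous.clm_finsetSum fun n ↦ ?_)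
    refine continuous_const.clm_comp (Continuous.clm_comp ?_ continuous_const)
    refine continuous_toEuclideanCLM.comp (Continuous.sub ?_ (hac n))
    split_ifs
    exacts [hPc, hMc]
  · rw [differenceOp_sub_coreApprox]
    exact norm_cutoff_comp_le (hb b) hε.le (hm m le_rfl b)

variable [CompactSpace B] [T2Space B] [ConnectedSpace B]

/-- The class is computed for T plus the tail of L - T, with the sequences supported at -1 as
transversal subspace. The remaining block is then added using a larger subspace. -/
theorem isIndexBundle_differenceOp (hac : ∀ n, Continuous (a n)) (hP : TendstoUniformly a P atTop)
    (hM : TendstoUniformly a M atBot) (hypP : ∀ b, IsHyperbolic (P b))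
    (hypM : ∀ b, IsHyperbolic (M b)) (hb : ∀ b, IsBoundedSeq fun n ↦ a n b) :
    ∃ (hEP : IsBundleFamily fun b ↦ stableSubspace (P b))
      (hEM : IsBundleFamily fun b ↦ stableSubspace (M b)),
      IsIndexBundle (fun b ↦ differenceOp (fun n ↦ a n b) (hb b))
        (KO.of hEP.toVect - KO.of hEM.toVect) := by
  have hPc : Continuous P := hP.continuous (Eventually.of_forall hac).frequently
  have hMc : Continuous M := hM.continuous (Eventually.of_forall hac).frequently
  have hprojP := isProjectionFamily_stableProj hPc hypP
  have hprojM := isProjectionFamily_stableProj hMc hypM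
  have hEP := hprojP.isBundleFamily fun b ↦ inferInstance
  have hEM := hprojM.isBundleFamily fun b ↦ inferInstance
  have hEU := hprojM.ker.isBundleFamily fun b ↦ inferInstance
  refine ⟨hEP, hEM, ?_⟩
  set L : B → SeqSpace N →L[ℝ] SeqSpace N := fun b ↦ differenceOp (fun n ↦ a n b) (hb b) with hL
  have hLc : Continuous L := continuous_differenceOp hac hP hM hPc hMc hb
  let T : B → SeqSpace N →L[ℝ] SeqSpace N := fun b ↦ stepOp (P b) (M b)
  let R : B → SeqSpace N →L[ℝ] SeqSpace N := fun b ↦ stepInv (P b) (M b)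
  have hTc : Continuous T := continuous_stepOp hPc hMc
  have hRc : Continuous R := continuous_stepInv hPc hMc hypP hypM
  have hTR : ∀ b, IsRightInverseMod (T b) (singleRange N) (R b) := fun b ↦
    isRightInverseMod_stepInv (hypP b) (hypM b)
  obtain ⟨C, hC0, hC⟩ := exists_norm_clm_le hRc
  -- The bound (C + 1)⁻¹ gives ‖D b‖‖R b‖ ≤ C / (C + 1) < 1, uniformly in the parameter.
  obtain ⟨m₀, hm₀⟩ := exists_forall_tailSet_norm_le hP hM
    (show 0 < (C + 1)⁻¹ by positivity)
  -- The added 1 ensures that the place -1 lies in [-m, m).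
  let m := m₀ + 1
  let D : B → SeqSpace N →L[ℝ] SeqSpace N := fun b ↦
    ZeroSeq.cutoff ℝ (tailSet m) ∘L (L b - T b)
  have hDc : Continuous D := continuous_const.clm_comp (hLc.clm_sub hTc)
  have hD : ∀ b, ‖D b‖ ≤ (C + 1)⁻¹ := fun b ↦
    norm_cutoff_comp_le (hb b) (by positivity) (hm₀ m (by omega) b)
  let L' : B → SeqSpace N →L[ℝ] SeqSpace N := fun b ↦ T b + D b
  have hL'c : Continuous L' := hTc.clm_add hDc
  have hL'T : ∀ b, L' b - T b = D b := fun b ↦ by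
    ext1 x
    exact add_sub_cancel_left (T b x) (D b x)
  have hunit : ∀ b, IsUnit (1 + (L' b - T b) ∘L R b) := fun b ↦ by
    rw [hL'T]
    refine isUnit_one_add_comp (hD b) (hC b) ?_
    rw [inv_mul_lt_one₀ (by positivity)]
    linarith
  let R' : B → SeqSpace N →L[ℝ] SeqSpace N := fun b ↦
    R b ∘L Ring.inverse (1 + (L' b - T b) ∘L R b)
  have hR'c : Continuous R' := hRc.clm_comp (continuous_ringInverse
    (continuous_const.clm_add ((hL'c.clm_sub hTc).clm_comp hRc)) hunit)
  have hL'R' : ∀ b, IsRightInverseMod (L' b) (singleRange N) (R' b) := fun b ↦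
    (hTR b).perturb (hunit b)
  have hclass := ((hEP.hasClass.prod hEU.hasClass).congr
    (familyIso_comap_stepOp hPc hMc hypP hypM).symm).congr
      (familyIso_comap_of_range_eq hTc hL'c hRc hR'c hTR hL'R' fun b ↦
        range_comp_inverse (hunit b))
  -- The trivial bundle of sequences supported at -1 splits as E^s(M) ⊕ E^u(M); the second summand
  -- also occurs in `hclass` and cancels in the difference.
  have hsplit := ((hEM.hasClass.prod hEU.hasClass).congr hprojM.familyIso_prod_ker).congr
    familyIso_singleRange.symm
  have hL'I := IsIndexBundle.of_hasClass hL'c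
    (fun b ↦ (hL'R' b).isFredholm (hclass.finiteDimensional b)) (fun b ↦ (hL'R' b).sup_eq_top) hclass
  rw [(hasClass_const (singleRange N)).unique hsplit, KO.of_add, KO.of_add,
    add_sub_add_right_eq_sub] at hL'I
  refine hL'I.congr_of_sub_mem hLc (V := coreSubspace N m) (fun b ↦ ?_) fun b x ↦ ?_
  · rw [← top_le_iff, ← (hL'R' b).sup_eq_top]
    exact sup_le_sup_left (singleRange_le_coreSubspace (by omega)) _
  -- On the tail L and L' coincide, so their difference is supported in [-m, m).
  · intro n hn
    have h1 : (L b x - L' b x) n =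
        (L b - T b) x n - ZeroSeq.cutoff ℝ (tailSet m) ((L b - T b) x) n :=
      sub_add_eq_sub_sub (L b x n) (T b x n) (D b x n)
    rw [h1, ZeroSeq.cutoff_apply_of_mem _ hn, sub_self]

end AsymptoticallyHyperbolic

theorem theorem4p1 (N : ℕ)
    (a : ℤ → Circle → GL (Fin N) ℝ)
    (ha : Continuous fun q : ℤ × Circle ↦ a q.1 q.2)
    (aPos aNeg : Circle → GL (Fin N) ℝ)
    (hPos : TendstoUniformly (fun n l ↦ (a n l : Matrix (Fin N) (Fin N) ℝ))
      (fun l ↦ (aPos l : Matrix (Fin N) (Fin N) ℝ)) atTop)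
    (hNeg : TendstoUniformly (fun n l ↦ (a n l : Matrix (Fin N) (Fin N) ℝ))
      (fun l ↦ (aNeg l : Matrix (Fin N) (Fin N) ℝ)) atBot)
    (hypPos : ∀ l, IsHyperbolic (aPos l : Matrix (Fin N) (Fin N) ℝ))
    (hypNeg : ∀ l, IsHyperbolic (aNeg l : Matrix (Fin N) (Fin N) ℝ)) :
    let L : Circle → SeqSpace N →L[ℝ] SeqSpace N := fun l ↦
      differenceOp (fun n ↦ (a n l : Matrix (Fin N) (Fin N) ℝ))
        (IsBoundedSeq.of_tendsto (hPos.tendsto_at l) (hNeg.tendsto_at l))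
    (∀ l, (L l).IsFredholm) ∧
    (∃ (hEPos : IsBundleFamily fun l ↦ stableSubspace (aPos l : Matrix (Fin N) (Fin N) ℝ))
       (hENeg : IsBundleFamily fun l ↦ stableSubspace (aNeg l : Matrix (Fin N) (Fin N) ℝ)),
      IsIndexBundle L (KO.of hEPos.toVect - KO.of hENeg.toVect)) ∧
    (∀ l, fredholmIndex (L l) =
      (Module.finrank ℝ (stableSubspace (aPos l : Matrix (Fin N) (Fin N) ℝ)) : ℤ) -
        (Module.finrank ℝ (stableSubspace (aNeg l : Matrix (Fin N) (Fin N) ℝ)) : ℤ)) := by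

  have hac : ∀ n, Continuous fun l ↦ (a n l : Matrix (Fin N) (Fin N) ℝ) := fun n ↦
    Units.continuous_val.comp (ha.comp (Continuous.prodMk_right n))
  obtain ⟨hEP, hEM, h⟩ := isIndexBundle_differenceOp hac hPos hNeg hypPos hypNeg
    fun l ↦ IsBoundedSeq.of_tendsto (hPos.tendsto_at l) (hNeg.tendsto_at l)
  refine ⟨h.isFredholm, ⟨hEP, hEM, h⟩, fun l ↦ ?_⟩
  -- The index at each point is the virtual rank of the index bundle.
  rw [← h.rank_eq l, map_sub, KO.rank_of, KO.rank_of, hEP.hasClass.rank_eq l,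
    hEM.hasClass.rank_eq l]
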